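/- Let $k\ge 1$ and let $(X_t)_{t\ge0}$ be a $k$-dimensional Lévy process (i.e. $X_0=0$ a.s., independent and stationary increments, and almost all paths right-continuous with finite left limits) whose characteristic exponent is rotationally invariant: for some $\psi:[0,\infty)\to\mathbb C$, $$\mathbb E e^{i\xi\cdot X_t}=e^{-t\psi(|\xi|)}\qquad\text{for all } t\ge 0,\ \xi\in\mathbb R^k .$$ Suppose that $\psi$ satisfies the Hartman--Wintner condition $\lim_{r\to\infty}\operatorname{Re}\psi(r)/\log r=\infty$. Then for every $t>0$ the random variable $X_t$ has a smooth rotationally invariant density with respect to Lebesgue measure, written $x\mapsto p_t^k(|x|)$, and the following statements are equivalent. (i) There exists a $(k+2)$-dimensional Lévy process $(X_t^{k+2})_{t\ge0}$ (on some probability space) with characteristic exponent $\xi\mapsto\psi(|\xi|)$, $\xi\in\mathbb R^{k+2}$. (ii) $\frac{d}{dr}p_t^k(r)\le 0$ for all $t>0$ and $r>0$. (iii) For every $t>0$, $X_t$ is unimodal isotropic, i.e. $\mathbb P(X_t\in dx)=c\,\delta_0(dx)+p(|x|)\,dx$ for some $c\in[0,1]$ and some non-increasing $p:(0,\infty)\to[0,\infty)$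 (both may depend on $t$). If one (hence all) of these conditions is satisfied, then for every process $(X_t^{k+2})_{t\ge 0}$ as in (i) and every $t>0$, $X_t^{k+2}$ has a smooth rotationally invariant density $x\mapsto p_t^{k+2}(|x|)$ on $\mathbb R^{k+2}$, and $$p_t^{k+2}(r)=-\frac1{2\pi}\,\frac1r\,\frac{d}{dr}p_t^k(r)\qquad\text{for all } r>0 .$$ -/

import Mathlib

open MeasureTheory ProbabilityTheory Filter Topology Set
open scoped NNReal ENNReal

noncomputable section

/-- A `d`-dimensional Lévy process: `X 0 = 0` almost surely, independent and stationary increments,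
and almost all paths are right-continuous with finite left limits. -/
structure IsLevyProcess {d : ℕ} {Ω : Type*} [MeasurableSpace Ω]
    (X : ℝ≥0 → Ω → EuclideanSpace ℝ (Fin d)) (P : Measure Ω) : Prop where
  measurable : ∀ t, Measurable (X t)
  zero_ae : ∀ᵐ ω ∂P, X 0 ω = 0
  indep_increments : HasIndepIncrements X P
  stationary_increments : ∀ s h : ℝ≥0,
    IdentDistrib (fun ω => X (s + h) ω - X s ω) (fun ω => X h ω - X 0 ω) P P
  cadlag : ∀ᵐ ω ∂P, ∀ t : ℝ≥0,
    ContinuousWithinAt (fun s => X s ω) (Ici t) t ∧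
      ∃ l : EuclideanSpace ℝ (Fin d), Tendsto (fun s => X s ω) (𝓝[<] t) (𝓝 l)

/-- `Ψ` is the characteristic exponent of the process `X`:
`𝔼 exp (i ξ · X_t) = exp (-t Ψ(ξ))` for all `t ≥ 0` and all `ξ`. -/
def HasCharExponent {d : ℕ} {Ω : Type*} [MeasurableSpace Ω]
    (X : ℝ≥0 → Ω → EuclideanSpace ℝ (Fin d)) (P : Measure Ω)
    (Ψ : EuclideanSpace ℝ (Fin d) → ℂ) : Prop :=
  ∀ (t : ℝ≥0) (ξ : EuclideanSpace ℝ (Fin d)),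
    charFun (P.map (X t)) ξ = Complex.exp (-(((t : ℝ) : ℂ) * Ψ ξ))

/-- There is a `d`-dimensional Lévy process on some probability space with characteristic
exponent `Ψ`. -/
def ExistsLevyProcess (d : ℕ) (Ψ : EuclideanSpace ℝ (Fin d) → ℂ) : Prop :=
  ∃ (Ω : Type) (_ : MeasurableSpace Ω) (P : Measure Ω) (X : ℝ≥0 → Ω → EuclideanSpace ℝ (Fin d)),
    IsProbabilityMeasure P ∧ IsLevyProcess X P ∧ HasCharExponent X P Ψ

/-- The Hartman–Wintner condition `Re ψ(r) / log r → ∞` as `r → ∞`. -/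
def HartmanWintner (ψ : ℝ → ℂ) : Prop :=
  Tendsto (fun r : ℝ => (ψ r).re / Real.log r) atTop atTop

/-- `X` is unimodal isotropic: its law is `c δ₀(dx) + p(|x|) dx` with `c ∈ [0,1]` and
`p : (0,∞) → [0,∞)` non-increasing. -/
def IsUnimodalIsotropic {d : ℕ} {Ω : Type*} [MeasurableSpace Ω]
    (X : Ω → EuclideanSpace ℝ (Fin d)) (P : Measure Ω) : Prop :=
  ∃ (c : ℝ) (p : ℝ → ℝ), c ∈ Icc (0 : ℝ) 1 ∧ (∀ r > 0, 0 ≤ p r) ∧ AntitoneOn p (Ioi 0) ∧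
    P.map X = ENNReal.ofReal c • Measure.dirac 0
      + (volume : Measure (EuclideanSpace ℝ (Fin d))).withDensity
          (fun x => ENNReal.ofReal (p ‖x‖))

/-- `p` is the radial profile of a smooth rotationally invariant Lebesgue density
`x ↦ p(|x|)` of `μ`. For `1 ≤ d`, the values of `p` on `[0,∞)` are determined by `μ`. -/
structure IsSmoothRadialDensity {d : ℕ} (μ : Measure (EuclideanSpace ℝ (Fin d)))
    (p : ℝ → ℝ) : Prop where
  nonneg : ∀ r, 0 ≤ r → 0 ≤ p r
  smooth : ContDiff ℝ ((⊤ : ℕ∞) : WithTop ℕ∞) (fun x : EuclideanSpace ℝ (Fin d) => p ‖x‖)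
  eq_withDensity : μ = (volume : Measure (EuclideanSpace ℝ (Fin d))).withDensity
    (fun x => ENNReal.ofReal (p ‖x‖))

end

/-!
The proof compares a radial law on `ℝᵏ⁺²` with its projection to `ℝᵏ`.

The Hartman–Wintner condition makes `exp (-t ψ(|ξ|))` decay faster than any power of `|ξ|`, so
Fourier inversion gives a smooth radial density for `t > 0`, in every dimension
(`exists_isSmoothRadialDensity`).

Let `μ` and `ν` be laws on `ℝᵏ` and `ℝᵏ⁺²` with the same radial characteristic function. The
characteristic function of the projection of `ν` is the restriction of that of `ν`, so `μ` is the
projection of `ν`. Integrating out two dimensions in polar coordinates shows that the profiles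
satisfy `p(r) = 2π ∫_r^∞ u q(u) du`, that is, `q(r) = -p'(r) / (2πr)`
(`IsSmoothRadialDensity.eq_deriv_of_charFun_eq`). This is the formula for the densities, and `q ≥ 0`
gives `p' ≤ 0`. Conversely, if `p' ≤ 0`, then `-p'(r) / (2πr)` is the profile of a radial
probability law on `ℝᵏ⁺²` whose projection is `μ`, and so has the same radial characteristic
function (`IsSmoothRadialDensity.exists_radial_lift`). For the laws of `X_t` this gives a
convolution semigroup on `ℝᵏ⁺²` with exponent `ψ(|ξ|)`.

It remains to realize this semigroup by a process with càdlàg paths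
(`existsLevyProcess_of_semigroup`). The i.i.d. increments over the dyadic grids of mesh `2⁻ⁿ` form
an inverse system, whose limit is a Markov chain in `n` (`exists_inverseLimit`). The required
regularity of the paths is inherited from `X`: each coordinate of the new process has the same
increment laws as a coordinate of `X`, and the event that the number of `ε`-oscillations over the
dyadic grids stays bounded as `n → ∞` has a probability that depends only on these laws
(`ae_exists_not_oscillatesBelow`). For `X` the event has probability one because the paths are
càdlàg (`exists_not_oscillatesBelow_of_cadlag`). Boundedly many oscillations give one-sided limits
along the dyadic numbers, the function of right limits is càdlàg, and the independence and the laws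
of the increments pass to the limit through characteristic functions.

Finally, a law with a smooth density has no atom at the origin, and its profile is non-increasing if
and only if it agrees almost everywhere with a non-increasing function, by continuity
(`IsSmoothRadialDensity.antitoneOn_iff_isUnimodalIsotropic`).
-/

/-! ### Densities by Fourier inversion -/

section FourierInversion

open scoped FourierTransform SchwartzMap ContDiff

variable {V : Type*} [NormedAddCommGroup V] [InnerProductSpace ℝ V] [FiniteDimensional ℝ V]
  [MeasurableSpace V] [BorelSpace V]

/-- Parseval's identity for a probability measure: in Mathlib's normalization, the Fourier
transform of `μ` at `v` is `charFun μ (-2πv)`, and both sides are the integral of that function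
against `𝓕⁻ g`. -/
theorem integral_schwartz_eq_integral_fourierInv (μ : Measure V) [IsProbabilityMeasure μ]
    (hφ : Integrable (fun v => charFun μ (-((2 * Real.pi) • v)))) (g : 𝓢(V, ℂ)) :
    ∫ x, g x ∂μ = ∫ x, g x * 𝓕⁻ (fun v => charFun μ (-((2 * Real.pi) • v))) x := by
  set φ : V → ℂ := fun v => charFun μ (-((2 * Real.pi) • v)) with hφdef
  have hL : Continuous fun p : V × V => (innerₗ V) p.1 p.2 := by
    simp only [innerₗ_apply_apply]; fun_prop
  have hLf : (innerₗ V).flip = innerₗ V := by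
    ext x y; simp
  -- Fubini for `g = 𝓕 (𝓕⁻ g)` against `μ`
  have h1 := VectorFourier.integral_fourierIntegral_smul_eq_flip (e := Real.fourierChar)
    (μ := (volume : Measure V)) (ν := μ) (f := (𝓕⁻ g : 𝓢(V, ℂ))) (g := fun _ => (1 : ℂ))
    (L := innerₗ V) Real.continuous_fourierChar hL (SchwartzMap.integrable _) (integrable_const _)
  -- Fubini for `g` against `𝓕⁻ φ`: the pairing `-⟪·,·⟫` makes both transforms inverse ones
  have h2 := VectorFourier.integral_fourierIntegral_smul_eq_flip (e := Real.fourierChar)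
    (μ := (volume : Measure V)) (ν := volume) (f := g) (g := φ)
    (L := -innerₗ V) Real.continuous_fourierChar
      (by simp only [LinearMap.neg_apply]; exact hL.neg) (SchwartzMap.integrable _) hφ
  have h3 : VectorFourier.fourierIntegral Real.fourierChar volume (innerₗ V)
      (𝓕⁻ g : 𝓢(V, ℂ)) = g := by
    change 𝓕 ((𝓕⁻ g : 𝓢(V, ℂ)) : V → ℂ) = g
    rw [← SchwartzMap.fourier_coe, FourierTransform.fourier_fourierInv_eq]
  have h4 : ∀ x, VectorFourier.fourierIntegral Real.fourierChar μ (innerₗ V).flip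
      (fun _ => (1 : ℂ)) x = φ x := by
    intro x
    rw [hφdef, hLf]
    simp only
    rw [charFun_eq_fourierIntegral']
    congr 1
    rw [smul_neg, neg_smul, neg_neg, smul_smul, inv_mul_cancel₀ (by positivity), one_smul]
  have h5 : VectorFourier.fourierIntegral Real.fourierChar volume (-innerₗ V) (g : V → ℂ)
      = (𝓕⁻ g : 𝓢(V, ℂ)) := by
    rw [SchwartzMap.fourierInv_coe]; rfl
  have h6 : VectorFourier.fourierIntegral Real.fourierChar volume (-innerₗ V).flip φ = 𝓕⁻ φ := by
    have : (-innerₗ V).flip = -innerₗ V := by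
      ext x y; simp [real_inner_comm]
    rw [this]; rfl
  rw [h3] at h1
  simp only [h4, smul_eq_mul, mul_one] at h1
  rw [h5, h6] at h2
  simp only [smul_eq_mul] at h2
  rw [h1, h2]

/-- A continuous function is nonnegative if its integrals against nonnegative test functions are:
otherwise a bump function supported where it is negative gives a contradiction. -/
theorem nonneg_of_forall_integral_contDiff_mul_nonneg {h : V → ℝ} (hc : Continuous h)
    (hh : ∀ g : V → ℝ, ContDiff ℝ ∞ g → HasCompactSupport g → (∀ x, 0 ≤ g x) →
      0 ≤ ∫ x, g x * h x) (x : V) : 0 ≤ h x := by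
  by_contra! hx
  obtain ⟨ε, hε, hball⟩ := Metric.isOpen_iff.1 (isOpen_lt hc continuous_const) x hx
  let f : ContDiffBump x := ⟨ε / 2, ε, by positivity, by linarith⟩
  have h1 := hh f f.contDiff f.hasCompactSupport (fun _ => f.nonneg)
  have hle : ∀ y, f y * h y ≤ 0 := by
    intro y
    by_cases hy : y ∈ Metric.ball x ε
    · exact mul_nonpos_of_nonneg_of_nonpos f.nonneg (hball hy).le
    · have : f y = 0 := f.zero_of_le_dist (by simpa using hy)
      simp [this]
  have hcont : Continuous fun y => -(f y * h y) := (f.continuous.mul hc).neg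
  have hpos : 0 < ∫ y, -(f y * h y) := by
    refine hcont.integral_pos_of_hasCompactSupport_nonneg_nonzero (x := x)
      f.hasCompactSupport.mul_right.neg (fun y => by simpa using hle y) ?_
    have : f x = 1 := f.one_of_mem_closedBall (Metric.mem_closedBall_self (by positivity))
    simp [this, hx.ne]
  rw [integral_neg] at hpos
  linarith

/-- A probability measure with integrable characteristic function has a continuous density, given
by Fourier inversion. -/
theorem eq_withDensity_of_integrable_charFun (μ : Measure V) [IsProbabilityMeasure μ]
    (hφ : Integrable (fun v => charFun μ (-((2 * Real.pi) • v)))) :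
    (∀ x, 0 ≤ (𝓕⁻ (fun v => charFun μ (-((2 * Real.pi) • v))) x).re) ∧
    μ = volume.withDensity (fun x => ENNReal.ofReal
      (𝓕⁻ (fun v => charFun μ (-((2 * Real.pi) • v))) x).re) := by
  set φ : V → ℂ := fun v => charFun μ (-((2 * Real.pi) • v)) with hφdef
  have hφc : Continuous φ := continuous_charFun.comp (by fun_prop)
  have hfc : Continuous (𝓕⁻ φ) := by
    rw [Real.fourierInv_eq_fourier_comp_neg]
    exact VectorFourier.fourierIntegral_continuous Real.continuous_fourierChar
      (by simp only [innerₗ_apply_apply]; fun_prop) hφ.comp_neg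
  -- testing against smooth compactly supported functions
  have htest : ∀ g : V → ℝ, ContDiff ℝ ∞ g → HasCompactSupport g →
      ((∫ x, g x ∂μ : ℝ) : ℂ) = ∫ x, (g x : ℂ) * 𝓕⁻ φ x := by
    intro g hg hgc
    have hgc' : HasCompactSupport (fun x => (g x : ℂ)) :=
      hgc.comp_left (g := Complex.ofReal) (by simp)
    have := integral_schwartz_eq_integral_fourierInv μ hφ
      (hgc'.toSchwartzMap (Complex.ofRealCLM.contDiff.comp hg))
    refine Eq.trans ?_ this
    exact integral_ofReal.symm
  have hint : ∀ g : V → ℝ, ContDiff ℝ ∞ g → HasCompactSupport g →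
      Integrable (fun x => (g x : ℂ) * 𝓕⁻ φ x) := by
    intro g hg hgc
    have hgc' : HasCompactSupport (fun x => (g x : ℂ)) :=
      hgc.comp_left (g := Complex.ofReal) (by simp)
    exact ((Complex.continuous_ofReal.comp hg.continuous).mul hfc).integrable_of_hasCompactSupport
      hgc'.mul_right
  have hre : ∀ g : V → ℝ, ContDiff ℝ ∞ g → HasCompactSupport g →
      ∫ x, g x ∂μ = ∫ x, g x * (𝓕⁻ φ x).re := by
    intro g hg hgc
    have h1 := congrArg Complex.re (htest g hg hgc)
    have h2 := Complex.reCLM.integral_comp_comm (hint g hg hgc)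
    rw [Complex.ofReal_re] at h1
    rw [h1]
    refine h2.symm.trans (integral_congr_ae (ae_of_all _ fun x => ?_))
    simp
  have him : ∀ g : V → ℝ, ContDiff ℝ ∞ g → HasCompactSupport g →
      ∫ x, g x * (𝓕⁻ φ x).im = 0 := by
    intro g hg hgc
    have h1 := congrArg Complex.im (htest g hg hgc)
    have h2 := Complex.imCLM.integral_comp_comm (hint g hg hgc)
    rw [Complex.ofReal_im] at h1
    rw [h1]
    refine Eq.trans (integral_congr_ae (ae_of_all _ fun x => ?_)) h2
    simp
  have hnn : ∀ x, 0 ≤ (𝓕⁻ φ x).re :=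
    nonneg_of_forall_integral_contDiff_mul_nonneg (Complex.continuous_re.comp hfc)
      fun g hg hgc hg0 => (hre g hg hgc) ▸ integral_nonneg hg0
  -- the density is real, since its imaginary part annihilates all test functions
  have him0 : ∀ x, (𝓕⁻ φ x).im = 0 := by
    intro x
    refine le_antisymm ?_ ?_
    · have := nonneg_of_forall_integral_contDiff_mul_nonneg (h := fun x => -(𝓕⁻ φ x).im)
        (Complex.continuous_im.comp hfc).neg
        (fun g hg hgc hg0 => by simp [integral_neg, him g hg hgc]) x
      simpa using this
    · exact nonneg_of_forall_integral_contDiff_mul_nonneg (Complex.continuous_im.comp hfc)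
        (fun g hg hgc hg0 => (him g hg hgc).ge) x
  have hf_eq : ∀ x, 𝓕⁻ φ x = ((𝓕⁻ φ x).re : ℂ) := fun x => by
    apply Complex.ext <;> simp [him0]
  have hrec : Continuous fun x => (𝓕⁻ φ x).re := Complex.continuous_re.comp hfc
  -- bump functions exhausting the space bound the total mass of the density
  have hrint : Integrable fun x => (𝓕⁻ φ x).re := by
    refine (aecover_closedBall (x := (0 : V)) (l := atTop)
      (tendsto_natCast_atTop_atTop (R := ℝ) |>.comp (tendsto_add_atTop_nat 1))
      ).integrable_of_integral_bounded_of_nonneg_ae 1 ?_ (ae_of_all _ hnn) (Eventually.of_forall ?_)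
    · intro n
      exact hrec.locallyIntegrable.integrableOn_isCompact (isCompact_closedBall _ _)
    · intro n
      let f : ContDiffBump (0 : V) :=
        ⟨((n + 1 : ℕ) : ℝ), (n + 2 : ℕ), by positivity, by push_cast; linarith⟩
      have hfi : Integrable fun x => f x * (𝓕⁻ φ x).re :=
        (f.continuous.mul hrec).integrable_of_hasCompactSupport f.hasCompactSupport.mul_right
      calc ∫ x in Metric.closedBall (0 : V) ((Nat.cast ∘ fun a => a + 1) n), (𝓕⁻ φ x).re
          = ∫ x in Metric.closedBall (0 : V) ((Nat.cast ∘ fun a => a + 1) n),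
            f x * (𝓕⁻ φ x).re := by
            refine setIntegral_congr_fun Metric.isClosed_closedBall.measurableSet fun x hx => ?_
            have : f x = 1 := f.one_of_mem_closedBall hx
            simp [this]
        _ ≤ ∫ x, f x * (𝓕⁻ φ x).re :=
            setIntegral_le_integral hfi (ae_of_all _ fun x => mul_nonneg f.nonneg (hnn x))
        _ = ∫ x, f x ∂μ := (hre _ f.contDiff f.hasCompactSupport).symm
        _ ≤ ∫ x, (1 : ℝ) ∂μ := by
            refine integral_mono_of_nonneg (ae_of_all _ fun x => f.nonneg) (integrable_const _)
              (ae_of_all _ fun x => f.le_one)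
        _ = 1 := by simp
  have hfint : Integrable (𝓕⁻ φ) := by
    rw [funext hf_eq]; exact hrint.ofReal
  have hFfint : Integrable (𝓕 φ) := by
    have : 𝓕 φ = fun x => 𝓕⁻ φ (-x) := by
      ext x; rw [Real.fourierInv_eq_fourier_neg, neg_neg]
    rw [this]; exact hfint.comp_neg
  -- integrability of `𝓕⁻ φ` allows inverting once more, which identifies the two measures
  have hinv : 𝓕 (𝓕⁻ φ) = φ := hφc.fourier_fourierInv_eq hφ hFfint
  refine ⟨hnn, ?_⟩
  have hfin : IsFiniteMeasure (volume.withDensity (fun x => ENNReal.ofReal (𝓕⁻ φ x).re)) :=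
    isFiniteMeasure_withDensity_ofReal hrint.2
  refine Measure.ext_of_charFun (funext fun ξ => ?_)
  have h1 : charFun μ ξ = 𝓕 (𝓕⁻ φ) (-((2 * Real.pi)⁻¹ • ξ)) := by
    rw [hinv]
    simp only [hφdef]
    rw [smul_neg, neg_neg, smul_smul, mul_inv_cancel₀ (by positivity), one_smul]
  have hmeas : Measurable fun x => ENNReal.ofReal (𝓕⁻ φ x).re :=
    ENNReal.measurable_ofReal.comp hrec.measurable
  rw [h1, charFun_apply, integral_withDensity_eq_integral_toReal_smul
    hmeas
    (ae_of_all _ fun x => ENNReal.ofReal_lt_top), Real.fourier_eq']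
  refine integral_congr_ae (ae_of_all _ fun x => ?_)
  change _ = (ENNReal.ofReal (𝓕⁻ φ x).re).toReal • _
  rw [ENNReal.toReal_ofReal (hnn x), Complex.real_smul, ← hf_eq x]
  beta_reduce
  rw [smul_eq_mul, mul_comm]
  congr 3
  rw [inner_neg_right, inner_smul_right]
  have := Real.pi_pos.ne'
  push_cast
  field_simp

end FourierInversion

/-! ### Smooth radial densities under the Hartman–Wintner condition -/

section RadialDensity

open scoped FourierTransform SchwartzMap ContDiff

variable {d : ℕ}

theorem exists_linearIsometryEquiv_eq {V : Type*} [NormedAddCommGroup V] [InnerProductSpace ℝ V]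
    {v w : V} (h : ‖v‖ = ‖w‖) : ∃ A : V ≃ₗᵢ[ℝ] V, A v = w :=
  ⟨_, Submodule.reflection_sub h⟩

/-- Under the Hartman–Wintner condition `exp (-t ψ(r))` decays faster than any power of `r`. -/
theorem HartmanWintner.norm_exp_isBigO {ψ : ℝ → ℂ} (hψ : HartmanWintner ψ) {t : ℝ} (ht : 0 < t)
    (N : ℕ) : (fun r : ℝ => Complex.exp (-((t : ℂ) * ψ r))) =O[atTop] fun r => r ^ (-(N : ℝ)) := by
  refine Asymptotics.IsBigO.of_bound 1 ?_
  filter_upwards [hψ.eventually_ge_atTop (N / t), eventually_gt_atTop 1] with r hr hr1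
  have hlog : 0 < Real.log r := Real.log_pos hr1
  rw [Complex.norm_exp, one_mul, Real.norm_of_nonneg (by positivity),
    Real.rpow_def_of_pos (by linarith)]
  refine Real.exp_le_exp.2 ?_
  rw [div_le_div_iff₀ ht hlog] at hr
  simp only [Complex.neg_re, Complex.re_ofReal_mul]
  nlinarith

/-- All moments of the Fourier transform are finite, which makes the density smooth. -/
theorem integrable_norm_pow_mul_charFun {ψ : ℝ → ℂ} (hψ : HartmanWintner ψ) {t : ℝ} (ht : 0 < t)
    (μ : Measure (EuclideanSpace ℝ (Fin d))) [IsProbabilityMeasure μ]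
    (hμ : ∀ ξ, charFun μ ξ = Complex.exp (-((t : ℂ) * ψ ‖ξ‖))) (n : ℕ) :
    Integrable (fun v => ‖v‖ ^ n * ‖charFun μ (-((2 * Real.pi) • v))‖) := by
  have hc : Continuous fun v : EuclideanSpace ℝ (Fin d) =>
      ‖v‖ ^ n * ‖charFun μ (-((2 * Real.pi) • v))‖ := by
    have : Continuous (charFun μ) := continuous_charFun
    fun_prop
  have hlin : Tendsto (fun v : EuclideanSpace ℝ (Fin d) => 2 * Real.pi * ‖v‖)
      (cocompact _) atTop :=
    (tendsto_norm_cocompact_atTop).const_mul_atTop (by positivity)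
  -- decay of order `d + 1` is integrable on `ℝᵈ`, the other `n` powers absorb `‖v‖ ^ n`
  have hO := (hψ.norm_exp_isBigO ht (n + (d + 1))).comp_tendsto hlin
  refine hc.locallyIntegrable.integrable_of_isBigO_cocompact
    (g := fun v => (1 + ‖v‖) ^ (-((d : ℝ) + 1))) ?_ ?_
  · have h1 : (fun v : EuclideanSpace ℝ (Fin d) => ‖v‖ ^ n * ‖charFun μ (-((2 * Real.pi) • v))‖)
        =O[cocompact _] fun v => ‖v‖ ^ n * (2 * Real.pi * ‖v‖) ^ (-((n + (d + 1) : ℕ) : ℝ)) := by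
      refine (Asymptotics.isBigO_refl _ _).mul (Asymptotics.IsBigO.norm_left ?_)
      refine (Asymptotics.isBigO_congr (Eventually.of_forall fun v => ?_) EventuallyEq.rfl).2 hO
      simp [hμ, norm_smul, abs_of_pos Real.pi_pos]
    refine h1.trans (Asymptotics.IsBigO.of_bound 1 ?_)
    filter_upwards [tendsto_norm_cocompact_atTop.eventually_ge_atTop 1] with v hv
    have hpi := Real.pi_gt_three
    have h2 : 1 + ‖v‖ ≤ 2 * Real.pi * ‖v‖ := by nlinarith
    rw [Real.norm_of_nonneg (by positivity), Real.norm_of_nonneg (by positivity), one_mul]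
    calc ‖v‖ ^ n * (2 * Real.pi * ‖v‖) ^ (-((n + (d + 1) : ℕ) : ℝ))
        ≤ (1 + ‖v‖) ^ n * (1 + ‖v‖) ^ (-((n + (d + 1) : ℕ) : ℝ)) := by
          refine mul_le_mul (pow_le_pow_left₀ (norm_nonneg _) (by linarith) _)
            (Real.rpow_le_rpow_of_nonpos (by positivity) h2 ?_) (by positivity) (by positivity)
          have : (0 : ℝ) ≤ ((n + (d + 1) : ℕ) : ℝ) := by positivity
          linarith
      _ = (1 + ‖v‖) ^ (-((d : ℝ) + 1)) := by
          rw [← Real.rpow_natCast, ← Real.rpow_add (by positivity)]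
          congr 1; push_cast; ring
  · exact (integrable_one_add_norm (by simp)).integrableAtFilter _

/-- Under the Hartman–Wintner condition the laws with characteristic function `exp (-t ψ(|ξ|))`
have smooth radial densities. -/
theorem exists_isSmoothRadialDensity (hd : 1 ≤ d) {ψ : ℝ → ℂ} (hψ : HartmanWintner ψ) {t : ℝ}
    (ht : 0 < t) (μ : Measure (EuclideanSpace ℝ (Fin d))) [IsProbabilityMeasure μ]
    (hμ : ∀ ξ, charFun μ ξ = Complex.exp (-((t : ℂ) * ψ ‖ξ‖))) :
    ∃ p : ℝ → ℝ, IsSmoothRadialDensity μ p := by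
  set φ : EuclideanSpace ℝ (Fin d) → ℂ := fun v => charFun μ (-((2 * Real.pi) • v)) with hφdef
  have hint := integrable_norm_pow_mul_charFun hψ ht μ hμ
  have hφc : Continuous φ := continuous_charFun.comp (by fun_prop)
  have hφ : Integrable φ := by
    have := hint 0
    simp only [pow_zero, one_mul] at this
    exact (integrable_norm_iff hφc.aestronglyMeasurable).1 this
  obtain ⟨hnn, hdens⟩ := eq_withDensity_of_integrable_charFun μ hφ
  -- the profile is the restriction of the density to the line through a unit vector
  let e : EuclideanSpace ℝ (Fin d) := EuclideanSpace.single ⟨0, hd⟩ 1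
  have he : ‖e‖ = 1 := by simp [e]
  have hrad : ∀ x : EuclideanSpace ℝ (Fin d), (𝓕⁻ φ (‖x‖ • e)).re = (𝓕⁻ φ x).re := by
    intro x
    obtain ⟨A, hA⟩ := exists_linearIsometryEquiv_eq (v := x) (w := ‖x‖ • e)
      (by simp [norm_smul, he])
    rw [← hA, ← Real.fourierInv_comp_linearIsometry]
    have : φ ∘ A = φ := by
      ext v; simp [φ, hμ, norm_smul]
    rw [this]
  refine ⟨fun r => (𝓕⁻ φ (r • e)).re, fun r _ => hnn _, ?_, ?_⟩
  · simp only [hrad]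
    have hF : ContDiff ℝ ((⊤ : ℕ∞) : WithTop ℕ∞) (𝓕 φ) := Real.contDiff_fourier fun n _ => hint n
    refine Complex.reCLM.contDiff.comp ?_
    have : 𝓕⁻ φ = fun x => 𝓕 φ (-x) := by ext x; rw [Real.fourierInv_eq_fourier_neg]
    rw [this]
    exact hF.comp contDiff_neg
  · simp only [hrad]
    exact hdens

end RadialDensity

/-! ### Integrating out two dimensions of a radial measure -/

section Projection

/-- The orthogonal decomposition of `ℝᵏ⁺²` as `ℝᵏ × ℂ`. -/
theorem exists_prodComplex_linearIsometryEquiv (k : ℕ) :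
    Nonempty (WithLp 2 (EuclideanSpace ℝ (Fin k) × ℂ) ≃ₗᵢ[ℝ] EuclideanSpace ℝ (Fin (k + 2))) := by
  have h : Module.finrank ℝ (WithLp 2 (EuclideanSpace ℝ (Fin k) × ℂ)) = k + 2 := by
    rw [(WithLp.linearEquiv 2 ℝ (EuclideanSpace ℝ (Fin k) × ℂ)).finrank_eq]
    simp
  exact ⟨((stdOrthonormalBasis ℝ _).reindex (finCongr h)).repr⟩

/-- The operation `Q ↦ 2π ∫_r^∞ u Q(u) du` on radial profiles. It sends the profile of a radial
measure on `ℝᵏ⁺²` to the profile of its projection to `ℝᵏ`. -/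
noncomputable def radialProjection (Q : ℝ → ℝ≥0∞) (r : ℝ) : ℝ≥0∞ :=
  ENNReal.ofReal (2 * Real.pi) * ∫⁻ u in Ioi r, ENNReal.ofReal u * Q u

/-- The substitution `u = √(r² + s²)`, for which `u du = s ds`. -/
theorem lintegral_Ioi_mul_sqrt_add_sq {Q : ℝ → ℝ≥0∞} {r : ℝ} (hr : 0 ≤ r) :
    ∫⁻ s in Ioi (0 : ℝ), ENNReal.ofReal s * Q √(r ^ 2 + s ^ 2)
      = ∫⁻ u in Ioi r, ENNReal.ofReal u * Q u := by
  have himage : (fun s : ℝ => √(r ^ 2 + s ^ 2)) '' Ioi 0 = Ioi r := by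
    ext u
    simp only [mem_image, mem_Ioi]
    constructor
    · rintro ⟨s, hs, rfl⟩
      refine Real.lt_sqrt_of_sq_lt ?_
      nlinarith
    · intro hu
      refine ⟨√(u ^ 2 - r ^ 2), Real.sqrt_pos.2 (by nlinarith), ?_⟩
      rw [Real.sq_sqrt (by nlinarith), add_sub_cancel, Real.sqrt_sq (hr.trans hu.le)]
  have hderiv : ∀ s ∈ Ioi (0 : ℝ), HasDerivWithinAt (fun s : ℝ => √(r ^ 2 + s ^ 2))
      (s / √(r ^ 2 + s ^ 2)) (Ioi 0) s := by
    intro s hs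
    have hs' : (0 : ℝ) < s := hs
    have h1 : HasDerivAt (fun s : ℝ => r ^ 2 + s ^ 2) (2 * s) s := by
      simpa using (hasDerivAt_pow 2 s).const_add (r ^ 2)
    have h2 := h1.sqrt (by positivity)
    convert! h2.hasDerivWithinAt using 1
    field_simp
  have hinj : InjOn (fun s : ℝ => √(r ^ 2 + s ^ 2)) (Ioi 0) := by
    intro s hs t ht hst
    have hs' : (0 : ℝ) < s := hs
    have ht' : (0 : ℝ) < t := ht
    have := (Real.sqrt_inj (by positivity) (by positivity)).1 hst
    nlinarith
  rw [← himage, lintegral_image_eq_lintegral_abs_deriv_mul measurableSet_Ioi hderiv hinj]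
  refine setLIntegral_congr_fun measurableSet_Ioi fun s hs => ?_
  have hs' : (0 : ℝ) < s := hs
  have hpos : 0 < √(r ^ 2 + s ^ 2) := by positivity
  rw [abs_of_nonneg (by positivity), ← mul_assoc, ← ENNReal.ofReal_mul (by positivity),
    div_mul_cancel₀ _ hpos.ne']

/-- The integral of a radial density over the two dimensions that are integrated out, computed in
polar coordinates of the plane. -/
theorem lintegral_complex_radial {Q : ℝ → ℝ≥0∞} (hQ : Measurable Q) {r : ℝ} (hr : 0 ≤ r) :
    ∫⁻ y : ℂ, Q √(r ^ 2 + ‖y‖ ^ 2) = radialProjection Q r := by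
  rw [← Complex.lintegral_comp_polarCoord_symm, radialProjection,
    ← lintegral_Ioi_mul_sqrt_add_sq hr]
  simp only [Complex.norm_polarCoord_symm, smul_eq_mul, sq_abs]
  have htar : polarCoord.target = Ioi (0 : ℝ) ×ˢ Ioo (-Real.pi) Real.pi := rfl
  rw [htar, Measure.volume_eq_prod, ← Measure.prod_restrict,
    lintegral_prod _ (by fun_prop)]
  simp only [lintegral_const, MeasurableSet.univ, Measure.restrict_apply, univ_inter,
    Real.volume_Ioo]
  rw [lintegral_mul_const _ (by fun_prop), mul_comm]
  congr 2
  ring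

variable {k : ℕ}

/-- The projection of a radial measure along `ℝᵏ⁺² ≃ ℝᵏ × ℂ → ℝᵏ` is radial, and its profile is
given by `radialProjection`. -/
theorem map_fst_withDensity_radial
    (L : WithLp 2 (EuclideanSpace ℝ (Fin k) × ℂ) ≃ₗᵢ[ℝ] EuclideanSpace ℝ (Fin (k + 2)))
    {Q : ℝ → ℝ≥0∞} (hQ : Measurable Q) :
    ((volume : Measure (EuclideanSpace ℝ (Fin (k + 2)))).withDensity (fun z => Q ‖z‖)).map
        (fun z => (L.symm z).fst)
      = (volume : Measure (EuclideanSpace ℝ (Fin k))).withDensity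
          (fun x => radialProjection Q ‖x‖) := by
  have hm : Measurable fun z => (L.symm z).fst := by
    have h1 : Measurable L.symm := L.symm.continuous.measurable
    have h2 : Measurable (WithLp.ofLp : WithLp 2 (EuclideanSpace ℝ (Fin k) × ℂ) → _) :=
      (WithLp.volume_preserving_ofLp _ _).measurable
    exact measurable_fst.comp (h2.comp h1)
  ext A hA
  rw [Measure.map_apply hm hA, withDensity_apply _ (hm hA), withDensity_apply _ hA]
  have hmp := L.measurePreserving.comp (WithLp.volume_preserving_toLp (EuclideanSpace ℝ (Fin k)) ℂ)
  rw [← hmp.setLIntegral_comp_preimage (hm hA) (by fun_prop)]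
  have hpre : (⇑L ∘ WithLp.toLp 2) ⁻¹' ((fun z => (L.symm z).fst) ⁻¹' A) = A ×ˢ (univ : Set ℂ) := by
    ext w; simp
  rw [hpre, Measure.volume_eq_prod, ← Measure.prod_restrict, Measure.restrict_univ,
    lintegral_prod _ (by
      have := hmp.measurable
      fun_prop)]
  refine setLIntegral_congr_fun hA fun x _ => ?_
  rw [← lintegral_complex_radial hQ (norm_nonneg x)]
  refine lintegral_congr fun y => ?_
  simp [WithLp.prod_norm_eq_of_L2]

theorem charFun_map_fst
    (L : WithLp 2 (EuclideanSpace ℝ (Fin k) × ℂ) ≃ₗᵢ[ℝ] EuclideanSpace ℝ (Fin (k + 2)))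
    (ν : Measure (EuclideanSpace ℝ (Fin (k + 2)))) (ξ : EuclideanSpace ℝ (Fin k)) :
    charFun (ν.map (fun z => (L.symm z).fst)) ξ = charFun ν (L (WithLp.toLp 2 (ξ, 0))) := by
  have hm : Measurable fun z => (L.symm z).fst := by
    have h1 : Measurable L.symm := L.symm.continuous.measurable
    have h2 : Measurable (WithLp.ofLp : WithLp 2 (EuclideanSpace ℝ (Fin k) × ℂ) → _) :=
      (WithLp.volume_preserving_ofLp _ _).measurable
    exact measurable_fst.comp (h2.comp h1)
  rw [charFun_apply, charFun_apply, integral_map hm.aemeasurable (by fun_prop)]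
  refine integral_congr_ae (ae_of_all _ fun z => ?_)
  beta_reduce
  congr 3
  conv_rhs => rw [← L.apply_symm_apply z, L.inner_map_map]
  simp [WithLp.prod_inner_apply]

theorem norm_toLp_fst
    (L : WithLp 2 (EuclideanSpace ℝ (Fin k) × ℂ) ≃ₗᵢ[ℝ] EuclideanSpace ℝ (Fin (k + 2)))
    (ξ : EuclideanSpace ℝ (Fin k)) : ‖L (WithLp.toLp 2 (ξ, 0))‖ = ‖ξ‖ := by
  simp

/-- The characteristic function of a radial law is radial. -/
theorem charFun_withDensity_radial_eq {d : ℕ} {Q : ℝ → ℝ≥0∞} (hQ : Measurable Q)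
    {ξ η : EuclideanSpace ℝ (Fin d)} (h : ‖ξ‖ = ‖η‖) :
    charFun (volume.withDensity (fun z => Q ‖z‖)) ξ
      = charFun (volume.withDensity (fun z => Q ‖z‖)) η := by
  obtain ⟨A, rfl⟩ := exists_linearIsometryEquiv_eq h
  set ν : Measure (EuclideanSpace ℝ (Fin d)) := volume.withDensity (fun z => Q ‖z‖) with hν
  have hA : Measurable A := A.continuous.measurable
  have hmap : ν.map A = ν := by
    ext s hs
    rw [Measure.map_apply hA hs, hν, withDensity_apply _ (hA hs), withDensity_apply _ hs,
      ← A.measurePreserving.setLIntegral_comp_preimage hs (by fun_prop)]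
    simp
  conv_rhs => rw [charFun_apply, ← hmap, integral_map hA.aemeasurable (by fun_prop)]
  simp only [A.inner_map_map]
  rw [charFun_apply]

end Projection

/-! ### Radial profiles -/

section Profiles

variable {d : ℕ}

/-- A property of the norm that holds almost everywhere holds on a dense set of radii. -/
theorem exists_mem_Ioo_of_ae_norm (hd : 1 ≤ d) {R : ℝ → Prop}
    (h : ∀ᵐ x : EuclideanSpace ℝ (Fin d), R ‖x‖) {a b : ℝ} (ha : 0 ≤ a) (hab : a < b) :
    ∃ r ∈ Ioo a b, R r := by
  have hopen : IsOpen {x : EuclideanSpace ℝ (Fin d) | ‖x‖ ∈ Ioo a b} :=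
    isOpen_Ioo.preimage continuous_norm
  have hne : {x : EuclideanSpace ℝ (Fin d) | ‖x‖ ∈ Ioo a b}.Nonempty := by
    refine ⟨EuclideanSpace.single ⟨0, hd⟩ ((a + b) / 2), ?_⟩
    have : |(a + b) / 2| = (a + b) / 2 := abs_of_nonneg (by linarith)
    simp only [Set.mem_ofPred_eq, PiLp.norm_single, Real.norm_eq_abs, this]
    constructor <;> linarith
  by_contra! hcon
  refine (hopen.measure_pos volume hne).ne' (measure_mono_null ?_ h)
  intro x hx hR
  exact hcon _ hx hR

/-- The values of a radial profile on `(-∞, 0)` are arbitrary. Replacing `p` by its even extension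
`u ↦ p |u|` gives a function that is smooth on all of `ℝ`. -/
theorem IsSmoothRadialDensity.contDiff_abs (hd : 1 ≤ d) {μ : Measure (EuclideanSpace ℝ (Fin d))}
    {p : ℝ → ℝ} (hp : IsSmoothRadialDensity μ p) :
    ContDiff ℝ ((⊤ : ℕ∞) : WithTop ℕ∞) (fun u : ℝ => p |u|) := by
  have h : ContDiff ℝ ((⊤ : ℕ∞) : WithTop ℕ∞)
      (fun u : ℝ => u • (EuclideanSpace.single ⟨0, hd⟩ 1 : EuclideanSpace ℝ (Fin d))) := by fun_prop
  have := hp.smooth.comp h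
  convert! this using 1
  ext u
  simp [norm_smul]

theorem eventuallyEq_comp_abs (p : ℝ → ℝ) {r : ℝ} (hr : 0 < r) :
    p =ᶠ[𝓝 r] fun u => p |u| := by
  filter_upwards [Ioi_mem_nhds hr] with u hu
  rw [abs_of_pos hu]

theorem IsSmoothRadialDensity.hasDerivAt (hd : 1 ≤ d) {μ : Measure (EuclideanSpace ℝ (Fin d))}
    {p : ℝ → ℝ} (hp : IsSmoothRadialDensity μ p) {r : ℝ} (hr : 0 < r) :
    HasDerivAt p (deriv p r) r := by
  have h := ((hp.contDiff_abs hd).differentiable (by simp)).differentiableAt (x := r)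
  exact ((eventuallyEq_comp_abs p hr).differentiableAt_iff.2 h).hasDerivAt

theorem IsSmoothRadialDensity.eq_withDensity_abs {μ : Measure (EuclideanSpace ℝ (Fin d))}
    {p : ℝ → ℝ} (hp : IsSmoothRadialDensity μ p) :
    μ = volume.withDensity (fun x => ENNReal.ofReal (p |‖x‖|)) := by
  simp only [abs_norm]
  exact hp.eq_withDensity

theorem IsSmoothRadialDensity.continuousOn (hd : 1 ≤ d) {μ : Measure (EuclideanSpace ℝ (Fin d))}
    {p : ℝ → ℝ} (hp : IsSmoothRadialDensity μ p) : ContinuousOn p (Ioi 0) :=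
  fun _ hr => (hp.hasDerivAt hd hr).continuousAt.continuousWithinAt

/-- A nonpositive derivative of the profile on `(0,∞)` means that the profile is non-increasing. -/
theorem IsSmoothRadialDensity.deriv_nonpos_iff (hd : 1 ≤ d)
    {μ : Measure (EuclideanSpace ℝ (Fin d))} {p : ℝ → ℝ} (hp : IsSmoothRadialDensity μ p) :
    (∀ r > 0, deriv p r ≤ 0) ↔ AntitoneOn p (Ioi 0) := by
  constructor
  · intro h
    refine antitoneOn_of_deriv_nonpos (convex_Ioi 0) (hp.continuousOn hd) ?_ ?_
    · rw [interior_Ioi]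
      exact fun r hr => (hp.hasDerivAt hd hr).differentiableAt.differentiableWithinAt
    · rw [interior_Ioi]
      exact fun r hr => h r hr
  · intro h r hr
    rw [← derivWithin_of_mem_nhds (Ioi_mem_nhds hr)]
    exact h.derivWithin_nonpos

/-- A non-increasing radial profile of a probability law vanishes at infinity. -/
theorem IsSmoothRadialDensity.tendsto_zero (hd : 1 ≤ d)
    {μ : Measure (EuclideanSpace ℝ (Fin d))} [IsProbabilityMeasure μ] {p : ℝ → ℝ}
    (hp : IsSmoothRadialDensity μ p) (hanti : AntitoneOn p (Ioi 0)) : Tendsto p atTop (𝓝 0) := by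
  have hsmall : ∀ ε > 0, ∃ r > 0, p r < ε := by
    by_contra! hcon
    obtain ⟨ε, hε, hcon⟩ := hcon
    have : Nonempty (Fin d) := ⟨⟨0, hd⟩⟩
    have h1 : ∫⁻ x : EuclideanSpace ℝ (Fin d), ENNReal.ofReal (p ‖x‖) = 1 := by
      rw [← measure_univ (μ := μ), hp.eq_withDensity]
      simp
    have h2 : ∫⁻ _ : EuclideanSpace ℝ (Fin d), ENNReal.ofReal ε
        ≤ ∫⁻ x : EuclideanSpace ℝ (Fin d), ENNReal.ofReal (p ‖x‖) := by
      refine lintegral_mono_ae ?_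
      filter_upwards [Measure.ae_ne volume (0 : EuclideanSpace ℝ (Fin d))] with x hx
      exact ENNReal.ofReal_le_ofReal (hcon _ (norm_pos_iff.2 hx))
    rw [h1, lintegral_const, measure_univ_of_isAddLeftInvariant,
      ENNReal.mul_top (by simpa using hε)] at h2
    simp at h2
  rw [Metric.tendsto_atTop]
  intro ε hε
  obtain ⟨r, hr, hpr⟩ := hsmall ε hε
  refine ⟨r, fun s hs => ?_⟩
  have hs0 : 0 < s := lt_of_lt_of_le hr hs
  rw [Real.dist_eq, sub_zero, abs_of_nonneg (hp.nonneg s hs0.le)]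
  exact (hanti hr hs0 hs).trans_lt hpr

/-- A law with a smooth radial density is unimodal isotropic if and only if the profile of this
density is non-increasing: it has no atom at the origin, and its profile is the continuous version
of the non-increasing one. -/
theorem IsSmoothRadialDensity.antitoneOn_iff_isUnimodalIsotropic (hd : 1 ≤ d) {Ω : Type*}
    [MeasurableSpace Ω] {P : Measure Ω} [IsProbabilityMeasure P] {X : Ω → EuclideanSpace ℝ (Fin d)}
    (hX : Measurable X) {p : ℝ → ℝ} (hp : IsSmoothRadialDensity (P.map X) p) :
    AntitoneOn p (Ioi 0) ↔ IsUnimodalIsotropic X P := by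
  have : Nonempty (Fin d) := ⟨⟨0, hd⟩⟩
  constructor
  · intro h
    refine ⟨0, p, by simp, fun r hr => hp.nonneg r hr.le, h, ?_⟩
    simpa using hp.eq_withDensity
  · rintro ⟨c, p', hc, hp'0, hp', heq⟩
    have hprob : IsProbabilityMeasure (P.map X) := Measure.isProbabilityMeasure_map hX.aemeasurable
    -- an absolutely continuous law has no atom at the origin
    have hc0 : ENNReal.ofReal c = 0 := by
      have h0 : P.map X {0} = 0 := by
        rw [hp.eq_withDensity]
        exact withDensity_absolutelyContinuous _ _ (measure_singleton 0)
      rw [heq] at h0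
      simpa using h0
    rw [hc0, zero_smul, zero_add, hp.eq_withDensity] at heq
    have hm : AEMeasurable (fun x : EuclideanSpace ℝ (Fin d) => ENNReal.ofReal (p' ‖x‖)) := by
      have h2 : Measurable ((Ioi (0 : ℝ)).domRestrict p') := by
        have : Antitone ((Ioi (0 : ℝ)).domRestrict p') := fun a b hab => hp' a.2 b.2 hab
        exact this.measurable
      have h3 : Measurable ((Ioi (0 : ℝ)).indicator p') :=
        measurable_of_restrict_of_restrict_compl measurableSet_Ioi
          (by
            convert! h2 using 1
            ext x
            simp)
          (by
            convert! (measurable_const (a := (0 : ℝ))) using 1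
            ext x
            simp [indicator_of_notMem x.2])
      refine ((ENNReal.measurable_ofReal.comp (h3.comp measurable_norm))).aemeasurable.congr ?_
      filter_upwards [Measure.ae_ne volume (0 : EuclideanSpace ℝ (Fin d))] with x hx
      simp [indicator_of_mem (show ‖x‖ ∈ Ioi (0 : ℝ) from norm_pos_iff.2 hx)]
    have hae : ∀ᵐ x : EuclideanSpace ℝ (Fin d), ENNReal.ofReal (p ‖x‖) = ENNReal.ofReal (p' ‖x‖) :=
      (withDensity_eq_iff
        (ENNReal.measurable_ofReal.comp hp.smooth.continuous.measurable).aemeasurable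
        hm (by
          rw [← setLIntegral_univ, ← withDensity_apply _ MeasurableSet.univ]
          change (volume.withDensity (fun x => ENNReal.ofReal (p ‖x‖))) univ ≠ ∞
          rw [← hp.eq_withDensity]
          simp)).1 heq
    have hcont := hp.continuousOn hd
    -- if `p a < p b` with `a < b`, both profiles agree at points `r < s` near `a` and `b`
    intro a ha b hb hab
    have ha' : (0 : ℝ) < a := ha
    rcases hab.eq_or_lt with rfl | hab
    · exact le_rfl
    by_contra! hlt
    obtain ⟨m, hm1, hm2⟩ := exists_between hlt
    have hUa := (hcont.continuousAt (Ioi_mem_nhds ha')).eventually_lt_const hm1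
    have hUb := (hcont.continuousAt (Ioi_mem_nhds (ha'.trans hab))).eventually_const_lt hm2
    obtain ⟨δ, hδ, hδa⟩ := Metric.eventually_nhds_iff.1 hUa
    obtain ⟨δ', hδ', hδb⟩ := Metric.eventually_nhds_iff.1 hUb
    obtain ⟨r, hr, hrR⟩ := exists_mem_Ioo_of_ae_norm
      (R := fun r => ENNReal.ofReal (p r) = ENNReal.ofReal (p' r)) hd hae ha'.le
      (show a < min (a + δ) b from lt_min (by linarith) hab)
    obtain ⟨s, hs, hsR⟩ := exists_mem_Ioo_of_ae_norm
      (R := fun r => ENNReal.ofReal (p r) = ENNReal.ofReal (p' r)) hd hae (ha'.trans hab).le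
      (show b < b + δ' by linarith)
    have hra : r < a + δ := hr.2.trans_le (min_le_left _ _)
    have hrb : r < b := hr.2.trans_le (min_le_right _ _)
    have hr0 : 0 < r := ha'.trans hr.1
    have hs0 : 0 < s := (ha'.trans hab).trans hs.1
    have e1 : p r = p' r :=
      (ENNReal.ofReal_eq_ofReal_iff (hp.nonneg r hr0.le) (hp'0 r hr0)).1 hrR
    have e2 : p s = p' s :=
      (ENNReal.ofReal_eq_ofReal_iff (hp.nonneg s hs0.le) (hp'0 s hs0)).1 hsR
    have h1 : p r < m := hδa (by rw [Real.dist_eq, abs_lt]; constructor <;> linarith [hr.1])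
    have h2 : m < p s := hδb (by rw [Real.dist_eq, abs_lt]; constructor <;> linarith [hs.1, hs.2])
    have h3 := hp' hr0 hs0 (hrb.trans hs.1).le
    linarith

end Profiles

/-! ### The relation between the profiles in dimensions `k` and `k + 2` -/

section DimensionWalk

variable {k : ℕ}

/-- If `μ` is the projection to `ℝᵏ` of a radial law `ν` on `ℝᵏ⁺²`, then the profiles satisfy
`p(r) = 2π ∫_r^∞ u q(u) du`, hence `p' = -2π r q`. -/
theorem IsSmoothRadialDensity.eq_deriv_of_map_fst (hk : 1 ≤ k)
    (L : WithLp 2 (EuclideanSpace ℝ (Fin k) × ℂ) ≃ₗᵢ[ℝ] EuclideanSpace ℝ (Fin (k + 2)))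
    {μ : Measure (EuclideanSpace ℝ (Fin k))} [IsProbabilityMeasure μ]
    {ν : Measure (EuclideanSpace ℝ (Fin (k + 2)))} {p q : ℝ → ℝ}
    (hp : IsSmoothRadialDensity μ p) (hq : IsSmoothRadialDensity ν q)
    (hmap : ν.map (fun z => (L.symm z).fst) = μ) {r : ℝ} (hr : 0 < r) :
    q r = -(1 / (2 * Real.pi)) * (1 / r) * deriv p r := by
  have hqc : Continuous fun u : ℝ => q |u| := (hq.contDiff_abs (by omega)).continuous
  have hpc : Continuous fun u : ℝ => p |u| := (hp.contDiff_abs hk).continuous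
  have hQ : Measurable fun u : ℝ => ENNReal.ofReal (q |u|) :=
    ENNReal.measurable_ofReal.comp hqc.measurable
  have hP : Measurable fun u : ℝ => ENNReal.ofReal (p |u|) :=
    ENNReal.measurable_ofReal.comp hpc.measurable
  have hTQ : Measurable (radialProjection fun u : ℝ => ENNReal.ofReal (q |u|)) := by
    have : Antitone (radialProjection fun u : ℝ => ENNReal.ofReal (q |u|)) := fun a b hab =>
      mul_le_mul_right (lintegral_mono_set (Ioi_subset_Ioi hab)) _
    exact this.measurable
  rw [hq.eq_withDensity_abs, map_fst_withDensity_radial L hQ, hp.eq_withDensity_abs] at hmap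
  have hae := (withDensity_eq_iff (hTQ.comp measurable_norm).aemeasurable
    (hP.comp measurable_norm).aemeasurable (by
      rw [← setLIntegral_univ, ← withDensity_apply _ MeasurableSet.univ]
      change (volume.withDensity
        (fun x : EuclideanSpace ℝ (Fin k) => radialProjection _ ‖x‖)) univ ≠ ∞
      rw [hmap, ← hp.eq_withDensity_abs]
      simp)).1 hmap
  -- the two profiles are only known to be related almost everywhere, hence on a dense set of radii
  set R : ℝ → Prop := fun r =>
    radialProjection (fun u : ℝ => ENNReal.ofReal (q |u|)) r = ENNReal.ofReal (p |r|) with hR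
  have hdense : ∀ a b : ℝ, 0 ≤ a → a < b → ∃ r ∈ Ioo a b, R r := fun a b ha hab =>
    exists_mem_Ioo_of_ae_norm (R := R) hk hae ha hab
  have huq : Continuous fun u : ℝ => 2 * Real.pi * (u * q |u|) :=
    (continuous_id.mul hqc).const_mul _
  -- the function `p(r) + 2π ∫₁^r u q(u) du` is constant on `(0,∞)`
  set h : ℝ → ℝ := fun r => p |r| + ∫ u in (1 : ℝ)..r, 2 * Real.pi * (u * q |u|) with hh
  have hhc : Continuous h :=
    hpc.add (intervalIntegral.continuous_primitive (fun a b => huq.intervalIntegrable a b) 1)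
  have hle : ∀ a b : ℝ, 0 < a → a < b → R a → R b → h a = h b := by
    intro a b ha hab hRa hRb
    have hpa := hp.nonneg a ha.le
    have hpb := hp.nonneg b (ha.trans hab).le
    have hnn : ∀ u ∈ Ioc a b, 0 ≤ 2 * Real.pi * (u * q |u|) := fun u hu => by
      have := hq.nonneg |u| (abs_nonneg u)
      have := (ha.trans hu.1).le
      positivity
    have hsplit : radialProjection (fun u : ℝ => ENNReal.ofReal (q |u|)) a
        = ENNReal.ofReal (∫ u in a..b, 2 * Real.pi * (u * q |u|))
          + radialProjection (fun u : ℝ => ENNReal.ofReal (q |u|)) b := by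
      rw [radialProjection, ← Ioc_union_Ioi_eq_Ioi hab.le,
        lintegral_union measurableSet_Ioi (Ioc_disjoint_Ioi le_rfl), mul_add, radialProjection]
      congr 1
      rw [intervalIntegral.integral_of_le hab.le, ofReal_integral_eq_lintegral_ofReal
        (huq.integrableOn_Ioc) ((ae_restrict_iff' measurableSet_Ioc).2 (ae_of_all _ hnn)),
        ← lintegral_const_mul _ (by fun_prop)]
      refine setLIntegral_congr_fun measurableSet_Ioc fun u hu => ?_
      have := (ha.trans hu.1).le
      rw [← ENNReal.ofReal_mul this, ← ENNReal.ofReal_mul (by positivity)]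
    have hI : 0 ≤ ∫ u in a..b, 2 * Real.pi * (u * q |u|) := by
      rw [intervalIntegral.integral_of_le hab.le]
      exact setIntegral_nonneg measurableSet_Ioc hnn
    rw [hRa, hRb, abs_of_pos ha, abs_of_pos (ha.trans hab), ← ENNReal.ofReal_add hI hpb,
      ENNReal.ofReal_eq_ofReal_iff hpa (by positivity)] at hsplit
    have hadd := intervalIntegral.integral_add_adjacent_intervals
      (huq.intervalIntegrable (μ := volume) 1 a) (huq.intervalIntegrable a b)
    simp only [hh, abs_of_pos ha, abs_of_pos (ha.trans hab)]
    rw [hsplit, ← hadd]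
    ring
  obtain ⟨c, hc, hRc⟩ := hdense 0 1 le_rfl one_pos
  have hD : ∀ a : ℝ, 0 < a → R a → h a = h c := by
    intro a ha hRa
    rcases lt_trichotomy a c with hac | rfl | hac
    · exact hle a c ha hac hRa hRc
    · rfl
    · exact (hle c a hc.1 hac hRc hRa).symm
  have hconst : ∀ a : ℝ, 0 < a → h a = h c := by
    intro a ha
    by_contra hne
    have hopen : IsOpen {x | h x ≠ h c} := isOpen_ne_fun hhc continuous_const
    obtain ⟨δ, hδ, hball⟩ := Metric.isOpen_iff.1 hopen a hne
    obtain ⟨x, hx, hRx⟩ := hdense a (a + δ) ha.le (by linarith)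
    refine hball (a := x) ?_ (hD x (ha.trans hx.1) hRx)
    rw [Metric.mem_ball, Real.dist_eq, abs_lt]
    constructor <;> linarith [hx.1, hx.2]
  have hprim : HasDerivAt (fun r => ∫ u in (1 : ℝ)..r, 2 * Real.pi * (u * q |u|))
      (2 * Real.pi * (r * q |r|)) r :=
    intervalIntegral.integral_hasDerivAt_right (huq.intervalIntegrable _ _)
      huq.stronglyMeasurable.stronglyMeasurableAtFilter huq.continuousAt
  have hpd : HasDerivAt p (-(2 * Real.pi * (r * q |r|))) r := by
    have h1 := (hasDerivAt_const r (h c)).sub hprim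
    rw [zero_sub] at h1
    refine h1.congr_of_eventuallyEq ?_
    filter_upwards [Ioi_mem_nhds hr] with u hu
    have h2 := hconst u hu
    simp only [hh, abs_of_pos (show (0 : ℝ) < u from hu)] at h2 ⊢
    simp only [Pi.sub_apply]
    linarith
  rw [hpd.deriv, abs_of_pos hr]
  have := Real.pi_pos.ne'
  field_simp

/-- A non-increasing radial profile on `ℝᵏ` is the projection of a radial law on `ℝᵏ⁺²`, namely
of the one with profile `-p'(r) / (2π r)`. -/
theorem IsSmoothRadialDensity.exists_radial_lift (hk : 1 ≤ k)
    {μ : Measure (EuclideanSpace ℝ (Fin k))} [IsProbabilityMeasure μ] {p : ℝ → ℝ}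
    (hp : IsSmoothRadialDensity μ p) (hanti : AntitoneOn p (Ioi 0)) :
    ∃ ν : Measure (EuclideanSpace ℝ (Fin (k + 2))), IsProbabilityMeasure ν ∧
      ∀ ξ η, ‖ξ‖ = ‖η‖ → charFun ν ξ = charFun μ η := by
  obtain ⟨L⟩ := exists_prodComplex_linearIsometryEquiv k
  have hderiv := (hp.deriv_nonpos_iff hk).2 hanti
  set Q : ℝ → ℝ≥0∞ := fun u => ENNReal.ofReal (-deriv p u / (2 * Real.pi * u)) with hQdef
  have hQ : Measurable Q := by
    have := measurable_deriv p
    fun_prop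
  -- `p(r) = -∫_r^∞ p'(u) du`, since `p` vanishes at infinity
  have hTQ : ∀ r > 0, radialProjection Q r = ENNReal.ofReal (p r) := by
    intro r hr
    have hd : ∀ u ∈ Ici r, HasDerivAt p (deriv p u) u := fun u hu =>
      hp.hasDerivAt hk (lt_of_lt_of_le hr hu)
    have hneg : ∀ u ∈ Ioi r, deriv p u ≤ 0 := fun u hu => hderiv u (hr.trans hu)
    have hlim := hp.tendsto_zero hk hanti
    have h1 := integral_Ioi_of_hasDerivAt_of_nonpos' hd hneg hlim
    have h2 : Integrable (fun u => -deriv p u) (volume.restrict (Ioi r)) :=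
      (integrableOn_Ioi_deriv_of_nonpos' hd hneg hlim).neg
    have h3 : p r = ∫ u in Ioi r, -deriv p u := by rw [integral_neg, h1]; ring
    rw [h3, ofReal_integral_eq_lintegral_ofReal h2
      ((ae_restrict_iff' measurableSet_Ioi).2 (ae_of_all _ fun u hu => by
        simpa using hneg u hu)), radialProjection, ← lintegral_const_mul _ (by fun_prop)]
    refine setLIntegral_congr_fun measurableSet_Ioi fun u hu => ?_
    have hu0 : 0 < u := hr.trans hu
    simp only [hQdef]
    rw [← ENNReal.ofReal_mul hu0.le, ← ENNReal.ofReal_mul (by positivity)]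
    congr 1
    have := Real.pi_pos.ne'
    field_simp
  have : Nonempty (Fin k) := ⟨⟨0, hk⟩⟩
  set ν : Measure (EuclideanSpace ℝ (Fin (k + 2))) := volume.withDensity (fun z => Q ‖z‖) with hν
  have hmap : ν.map (fun z => (L.symm z).fst) = μ := by
    rw [hν, map_fst_withDensity_radial L hQ, hp.eq_withDensity]
    refine withDensity_congr_ae ?_
    filter_upwards [Measure.ae_ne volume (0 : EuclideanSpace ℝ (Fin k))] with x hx
    exact hTQ _ (norm_pos_iff.2 hx)
  -- the image of `ν` under a non-measurable map would be zero, but it is the probability `μ`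
  have hae : AEMeasurable (fun z => (L.symm z).fst) ν := by
    by_contra hcon
    rw [Measure.map_of_not_aemeasurable hcon] at hmap
    exact IsProbabilityMeasure.ne_zero μ hmap.symm
  refine ⟨ν, ⟨?_⟩, fun ξ η h => ?_⟩
  · rw [← measure_univ (μ := μ), ← hmap, Measure.map_apply_of_aemeasurable hae MeasurableSet.univ,
      preimage_univ]
  · rw [← hmap, charFun_map_fst]
    exact charFun_withDensity_radial_eq hQ (by rw [norm_toLp_fst, h])

end DimensionWalk

/-! ### Counting oscillations -/

section Oscillations

variable {ι κ : Type*} [LinearOrder ι] [LinearOrder κ]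

/-- `OscillatesBelow f S ε N t`: the restriction of `f` to `S` makes at least `N` successive
oscillations larger than `ε` up to time `t`, that is, there are times
`s₁ < s₁' ≤ s₂ < s₂' ≤ ⋯ ≤ s_N < s_N' ≤ t` in `S` with `|f sᵢ' - f sᵢ| > ε`. The recursion
splits off the last oscillation. -/
def OscillatesBelow (f : ι → ℝ) (S : Set ι) (ε : ℝ) : ℕ → ι → Prop
  | 0, _ => True
  | N + 1, t => ∃ s ∈ S, ∃ s' ∈ S, s < s' ∧ s' ≤ t ∧ ε < |f s' - f s| ∧ OscillatesBelow f S ε N s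

theorem OscillatesBelow.mono {f : ι → ℝ} {S : Set ι} {ε : ℝ} {N : ℕ} {t t' : ι}
    (h : OscillatesBelow f S ε N t) (ht : t ≤ t') : OscillatesBelow f S ε N t' := by
  cases N with
  | zero => trivial
  | succ N =>
    obtain ⟨s, hs, s', hs', h1, h2, h3, h4⟩ := h
    exact ⟨s, hs, s', hs', h1, h2.trans ht, h3, h4⟩

theorem OscillatesBelow.of_succ {f : ι → ℝ} {S : Set ι} {ε : ℝ} {N : ℕ} {t : ι}
    (h : OscillatesBelow f S ε (N + 1) t) : OscillatesBelow f S ε N t := by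
  obtain ⟨s, hs, s', hs', h1, h2, h3, h4⟩ := h
  exact h4.mono (h1.le.trans h2)

theorem OscillatesBelow.anti {f : ι → ℝ} {S : Set ι} {ε : ℝ} {M N : ℕ} {t : ι}
    (h : OscillatesBelow f S ε N t) (hMN : M ≤ N) : OscillatesBelow f S ε M t := by
  induction N, hMN using Nat.le_induction with
  | base => exact h
  | succ n _ ih => exact ih h.of_succ

/-- Refining the set of times can only increase the number of oscillations. -/
theorem OscillatesBelow.of_comp {f : ι → ℝ} {ε : ℝ} {g : κ → ι} (hg : StrictMono g) {N : ℕ}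
    {t : κ} (h : OscillatesBelow (fun s => f (g s)) univ ε N t) :
    OscillatesBelow f univ ε N (g t) := by
  induction N generalizing t with
  | zero => trivial
  | succ N ih =>
    obtain ⟨s, hs, s', hs', h1, h2, h3, h4⟩ := h
    exact ⟨g s, mem_univ _, g s', mem_univ _, hg h1, hg.monotone h2, h3, ih h4⟩

theorem oscillatesBelow_add_const {f : ι → ℝ} {S : Set ι} {ε : ℝ} (c : ℝ) {N : ℕ} {t : ι} :
    OscillatesBelow (fun s => f s + c) S ε N t ↔ OscillatesBelow f S ε N t := by
  induction N generalizing t with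
  | zero => simp [OscillatesBelow]
  | succ N ih => simp only [OscillatesBelow, ih, add_sub_add_right_eq_sub]

theorem measurableSet_oscillatesBelow {Ω : Type*} [MeasurableSpace Ω] [Countable ι]
    {f : ι → Ω → ℝ} (hf : ∀ i, Measurable (f i)) (ε : ℝ) (N : ℕ) (t : ι) :
    MeasurableSet {ω | OscillatesBelow (fun i => f i ω) univ ε N t} := by
  induction N generalizing t with
  | zero => simp [OscillatesBelow]
  | succ N ih =>
    have : {ω | OscillatesBelow (fun i => f i ω) univ ε (N + 1) t}
        = ⋃ s, ⋃ s', {ω | (s < s' ∧ s' ≤ t) ∧ ε < |f s' ω - f s ω|}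
            ∩ {ω | OscillatesBelow (fun i => f i ω) univ ε N s} := by
      ext ω
      simp [OscillatesBelow, and_assoc]
    rw [this]
    refine MeasurableSet.iUnion fun s => MeasurableSet.iUnion fun s' =>
      MeasurableSet.inter ?_ (ih s)
    refine (MeasurableSet.const _).inter ?_
    exact measurableSet_lt measurable_const (((hf s').sub (hf s)).abs)

/-- A function with one-sided limits that is right-continuous has finitely many oscillations
larger than `ε` on bounded intervals. -/
theorem exists_not_oscillatesBelow_of_cadlag {f : ℝ≥0 → ℝ}
    (hf : ∀ t, ContinuousWithinAt f (Ici t) t ∧ ∃ l, Tendsto f (𝓝[<] t) (𝓝 l)) {ε : ℝ}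
    (hε : 0 < ε) (T : ℝ≥0) : ∃ N, ¬ OscillatesBelow f univ ε N T := by
  by_contra! hT
  set C : Set ℝ≥0 := {t | ∀ N, OscillatesBelow f univ ε N t} with hC
  -- the first time at which infinitely many oscillations accumulate
  set τ := sInf C with hτ
  have hne : C.Nonempty := ⟨T, hT⟩
  have hlt : ∀ t < τ, ∃ N, ¬ OscillatesBelow f univ ε N t := by
    intro t ht
    by_contra! h
    exact (csInf_le (OrderBot.bddBelow C) (show t ∈ C from h)).not_gt ht
  have hclose : ∀ {l x y : ℝ}, dist x l < ε / 2 → dist y l < ε / 2 → ¬ ε < |x - y| := by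
    intro l x y hx hy h
    have := dist_triangle_right x y l
    rw [Real.dist_eq x y] at this
    linarith
  -- the left limit at the infimum keeps the number of oscillations up to it finite
  have hτN : ∃ N, ¬ OscillatesBelow f univ ε N τ := by
    rcases eq_or_ne τ 0 with h0 | h0
    · refine ⟨1, ?_⟩
      rintro ⟨s, -, s', -, h1, h2, -, -⟩
      rw [h0] at h2
      exact not_lt_zero (h1.trans_le h2)
    · obtain ⟨l, hl⟩ := (hf τ).2
      have hev := hl.eventually (Metric.ball_mem_nhds l (half_pos hε))
      obtain ⟨a, ha, hball⟩ := (mem_nhdsLT_iff_exists_Ioo_subset' (pos_iff_ne_zero.2 h0)).1 hev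
      obtain ⟨N, hN⟩ := hlt a ha
      refine ⟨N + 2, ?_⟩
      rintro ⟨s, -, s', -, h1, h2, -, r, -, r', -, h3, h4, h5, h6⟩
      rcases le_or_gt r a with hra | hra
      · exact hN (h6.mono hra)
      · have hsτ : s < τ := h1.trans_le h2
        exact hclose (hball ⟨hra.trans h3, h4.trans_lt hsτ⟩)
          (hball ⟨hra, h3.trans (h4.trans_lt hsτ)⟩) h5
  -- right-continuity excludes further oscillations shortly after the infimum
  obtain ⟨N, hN⟩ := hτN
  have hev := (hf τ).1.eventually (Metric.ball_mem_nhds (f τ) (half_pos hε))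
  obtain ⟨b, hb, hball⟩ := (mem_nhdsGE_iff_exists_Ico_subset' (lt_add_one τ)).1 hev
  have hle : b ≤ τ := by
    refine le_csInf hne fun t ht => ?_
    by_contra! htb
    obtain ⟨s, -, s', -, h1, h2, h3, h4⟩ := ht (N + 1)
    rcases lt_or_ge s τ with hs | hs
    · exact hN (h4.mono hs.le)
    · exact hclose (hball ⟨hs.trans h1.le, h2.trans_lt htb⟩)
        (hball ⟨hs, h1.trans (h2.trans_lt htb)⟩) h3
  exact hle.not_gt hb

/-- A function that is not Cauchy along a filter oscillates by a fixed amount on every set of the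
filter. -/
theorem exists_tendsto_or_oscillation {f : ℝ≥0 → ℝ} (l : Filter ℝ≥0) :
    (∃ y, Tendsto f l (𝓝 y)) ∨
      ∃ ε > 0, ∀ u ∈ l, ∃ s ∈ u, ∃ s' ∈ u, s < s' ∧ ε < |f s' - f s| := by
  rcases l.eq_or_neBot with rfl | hl
  · exact Or.inl ⟨0, tendsto_bot⟩
  by_cases hc : Cauchy (map f l)
  · exact Or.inl (cauchy_map_iff_exists_tendsto.1 hc)
  right
  rw [Metric.cauchy_iff] at hc
  push Not at hc
  obtain ⟨ε, hε, h⟩ := hc inferInstance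
  refine ⟨ε / 2, by positivity, fun u hu => ?_⟩
  obtain ⟨x, ⟨s, hs, rfl⟩, y, ⟨s', hs', rfl⟩, hxy⟩ := h (f '' u) (image_mem_map hu)
  rw [Real.dist_eq] at hxy
  rcases lt_trichotomy s s' with hlt | rfl | hlt
  · exact ⟨s, hs, s', hs', hlt, by rw [abs_sub_comm]; linarith⟩
  · simp at hxy; linarith
  · exact ⟨s', hs', s, hs, hlt, by linarith⟩

/-- Boundedly many oscillations along `S` give right limits along `S`: without a limit at `t`,
there would be an oscillation in `S ∩ (t, u)` for every `u > t`. -/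
theorem exists_tendsto_nhdsGT_of_not_oscillatesBelow {f : ℝ≥0 → ℝ} {S : Set ℝ≥0}
    (hf : ∀ ε > 0, ∀ T, ∃ N, ¬ OscillatesBelow f S ε N T) (t : ℝ≥0) :
    ∃ y, Tendsto f (𝓝[S ∩ Ioi t] t) (𝓝 y) := by
  refine (exists_tendsto_or_oscillation _).resolve_right ?_
  rintro ⟨ε, hε, h⟩
  have hosc : ∀ N, ∀ u > t, OscillatesBelow f S ε N u := by
    intro N
    induction N with
    | zero => exact fun _ _ => trivial
    | succ N ih =>
      intro u hu
      obtain ⟨s, hs, s', hs', h1, h2⟩ := h ((S ∩ Ioi t) ∩ Iio u)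
        (inter_mem self_mem_nhdsWithin (mem_nhdsWithin_of_mem_nhds (Iio_mem_nhds hu)))
      exact ⟨s, hs.1.1, s', hs'.1.1, h1, hs'.2.le, h2, ih s hs.1.2⟩
  obtain ⟨N, hN⟩ := hf ε hε (t + 1)
  exact hN (hosc N _ (lt_add_one t))

/-- Boundedly many oscillations along `S` give left limits along `S`. -/
theorem exists_tendsto_nhdsLT_of_not_oscillatesBelow {f : ℝ≥0 → ℝ} {S : Set ℝ≥0}
    (hf : ∀ ε > 0, ∀ T, ∃ N, ¬ OscillatesBelow f S ε N T) (t : ℝ≥0) :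
    ∃ y, Tendsto f (𝓝[S ∩ Iio t] t) (𝓝 y) := by
  rcases eq_or_ne t 0 with rfl | ht
  · refine ⟨0, ?_⟩
    simp
  refine (exists_tendsto_or_oscillation _).resolve_right ?_
  rintro ⟨ε, hε, h⟩
  have hosc : ∀ N, ∃ u < t, OscillatesBelow f S ε N u := by
    intro N
    induction N with
    | zero => exact ⟨0, pos_iff_ne_zero.2 ht, trivial⟩
    | succ N ih =>
      obtain ⟨u, hu, hu'⟩ := ih
      obtain ⟨s, hs, s', hs', h1, h2⟩ := h ((S ∩ Iio t) ∩ Ioi u)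
        (inter_mem self_mem_nhdsWithin (mem_nhdsWithin_of_mem_nhds (Ioi_mem_nhds hu)))
      exact ⟨s', hs'.1.2, s, hs.1.1, s', hs'.1.1, h1, le_rfl, h2, hu'.mono (le_of_lt hs.2)⟩
  obtain ⟨N, hN⟩ := hf ε hε t
  obtain ⟨u, hu, hu'⟩ := hosc N
  exact hN (hu'.mono hu.le)

end Oscillations

/-! ### Functions of right limits -/

section RightLimits

variable {E : Type*} [TopologicalSpace E] [RegularSpace E]

/-- The function of right limits along a set `S` is right-continuous. -/
theorem continuousWithinAt_of_tendsto_nhdsGT {f G : ℝ≥0 → E} {S : Set ℝ≥0}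
    (hS : ∀ t, (𝓝[S ∩ Ioi t] t).NeBot) (hG : ∀ t, Tendsto f (𝓝[S ∩ Ioi t] t) (𝓝 (G t)))
    (t : ℝ≥0) : ContinuousWithinAt G (Ici t) t := by
  refine (closed_nhds_basis (G t)).tendsto_right_iff.2 fun U hU => ?_
  obtain ⟨W, hW, htW, hsub⟩ := mem_nhdsWithin.1 (hG t hU.1)
  filter_upwards [mem_nhdsWithin_of_mem_nhds (hW.mem_nhds htW), self_mem_nhdsWithin] with u hu htu
  refine hU.2.mem_of_tendsto (hG u) ?_
  filter_upwards [mem_nhdsWithin_of_mem_nhds (hW.mem_nhds hu), self_mem_nhdsWithin] with s hs hs'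
  exact hsub ⟨hs, hs'.1, (mem_Ici.1 htu).trans_lt hs'.2⟩

/-- The function of right limits along a set `S` has the left limits of the original function
along `S`. -/
theorem tendsto_nhdsLT_of_tendsto_nhdsGT {f G : ℝ≥0 → E} {S : Set ℝ≥0}
    (hS : ∀ t, (𝓝[S ∩ Ioi t] t).NeBot) (hG : ∀ t, Tendsto f (𝓝[S ∩ Ioi t] t) (𝓝 (G t)))
    {t : ℝ≥0} {l : E} (hl : Tendsto f (𝓝[S ∩ Iio t] t) (𝓝 l)) : Tendsto G (𝓝[<] t) (𝓝 l) := by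
  refine (closed_nhds_basis l).tendsto_right_iff.2 fun U hU => ?_
  obtain ⟨W, hW, htW, hsub⟩ := mem_nhdsWithin.1 (hl hU.1)
  filter_upwards [mem_nhdsWithin_of_mem_nhds (hW.mem_nhds htW), self_mem_nhdsWithin] with u hu htu
  refine hU.2.mem_of_tendsto (hG u) ?_
  filter_upwards [mem_nhdsWithin_of_mem_nhds (hW.mem_nhds hu),
    mem_nhdsWithin_of_mem_nhds (Iio_mem_nhds htu), self_mem_nhdsWithin] with s hs hst hs'
  exact hsub ⟨hs, hs'.1, hst⟩

end RightLimits

/-! ### Dyadic numbers -/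

section Dyadic

/-- The dyadic number `j / 2ⁿ`. -/
noncomputable def dyadic (n j : ℕ) : ℝ≥0 := j / 2 ^ n

/-- The set of nonnegative dyadic numbers. -/
def dyadics : Set ℝ≥0 := {t | ∃ n j, t = dyadic n j}

theorem dyadic_strictMono (n : ℕ) : StrictMono (dyadic n) := by
  intro i j hij
  unfold dyadic
  gcongr

theorem dyadic_add (n m j : ℕ) : dyadic (n + m) (2 ^ m * j) = dyadic n j := by
  unfold dyadic
  rw [pow_add]
  push_cast
  field_simp

theorem dyadic_zero (n : ℕ) : dyadic n 0 = 0 := by simp [dyadic]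

/-- The index of the dyadic number of level `n` next to `t` on the right. It is strictly larger
than `t` even if `t` is dyadic, so that limits along it are limits from the right. -/
noncomputable def dyadicAbove (n : ℕ) (t : ℝ≥0) : ℕ := ⌊t * 2 ^ n⌋₊ + 1

theorem lt_dyadic_dyadicAbove (n : ℕ) (t : ℝ≥0) : t < dyadic n (dyadicAbove n t) := by
  unfold dyadic dyadicAbove
  rw [lt_div_iff₀ (by positivity)]
  exact_mod_cast Nat.lt_floor_add_one (t * 2 ^ n)

theorem dyadic_dyadicAbove_le (n : ℕ) (t : ℝ≥0) :
    dyadic n (dyadicAbove n t) ≤ t + (1 / 2) ^ n := by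
  unfold dyadic dyadicAbove
  rw [div_le_iff₀ (by positivity), add_mul, one_div, inv_pow, inv_mul_cancel₀ (by positivity)]
  push_cast
  gcongr
  exact Nat.floor_le (by positivity)

theorem dyadicAbove_mono (n : ℕ) : Monotone (dyadicAbove n) := by
  intro s t hst
  unfold dyadicAbove
  gcongr

theorem tendsto_dyadic_dyadicAbove (t : ℝ≥0) :
    Tendsto (fun n => dyadic n (dyadicAbove n t)) atTop (𝓝 t) := by
  have h : Tendsto (fun n : ℕ => t + (1 / 2 : ℝ≥0) ^ n) atTop (𝓝 (t + 0)) :=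
    (NNReal.tendsto_pow_atTop_nhds_zero_of_lt_one (by
      rw [← NNReal.coe_lt_coe]; norm_num)).const_add t
  rw [add_zero] at h
  exact tendsto_of_tendsto_of_tendsto_of_le_of_le tendsto_const_nhds h
    (fun n => (lt_dyadic_dyadicAbove n t).le) (fun n => dyadic_dyadicAbove_le n t)

theorem tendsto_dyadic_dyadicAbove_nhdsWithin (t : ℝ≥0) :
    Tendsto (fun n => dyadic n (dyadicAbove n t)) atTop (𝓝[dyadics ∩ Ioi t] t) :=
  tendsto_nhdsWithin_iff.2 ⟨tendsto_dyadic_dyadicAbove t,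
    Eventually.of_forall fun n => ⟨⟨_, _, rfl⟩, lt_dyadic_dyadicAbove n t⟩⟩

theorem neBot_nhdsWithin_dyadics_Ioi (t : ℝ≥0) : (𝓝[dyadics ∩ Ioi t] t).NeBot :=
  (tendsto_dyadic_dyadicAbove_nhdsWithin t).neBot

open Classical in
/-- The function on the dyadic numbers with value `S n j` at `j / 2ⁿ`, extended by zero. The
representation of a dyadic number is chosen arbitrarily, so the definition is meaningful only if
`S (n + 1) (2 * j) = S n j`. -/
noncomputable def dyadicPath {E : Type*} [Zero E] (S : ℕ → ℕ → E) (t : ℝ≥0) : E :=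
  if h : ∃ n j, t = dyadic n j then S h.choose h.choose_spec.choose else 0

theorem eq_add_of_consistent {E : Type*} {S : ℕ → ℕ → E}
    (hS : ∀ n j, S (n + 1) (2 * j) = S n j) (n m j : ℕ) : S (n + m) (2 ^ m * j) = S n j := by
  induction m with
  | zero => simp
  | succ m ih => rw [← ih, ← hS (n + m), ← add_assoc, pow_succ']; ring_nf

theorem dyadicPath_dyadic {E : Type*} [Zero E] {S : ℕ → ℕ → E}
    (hS : ∀ n j, S (n + 1) (2 * j) = S n j) (n j : ℕ) :
    dyadicPath S (dyadic n j) = S n j := by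
  have h : ∃ n' j', dyadic n j = dyadic n' j' := ⟨n, j, rfl⟩
  rw [dyadicPath, dif_pos h]
  set n' := h.choose
  set j' := h.choose_spec.choose
  have h' : dyadic n j = dyadic n' j' := h.choose_spec.choose_spec
  rw [← eq_add_of_consistent hS n n' j, ← eq_add_of_consistent hS n' n j', add_comm n' n]
  congr 1
  rw [← dyadic_add n n' j, ← dyadic_add n' n j', add_comm n' n] at h'
  exact ((dyadic_strictMono _).injective h').symm

/-- Finitely many oscillations along the dyadic numbers are visible at a sufficiently fine
level. -/
theorem OscillatesBelow.exists_level {S : ℕ → ℕ → ℝ} (hS : ∀ n j, S (n + 1) (2 * j) = S n j)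
    {ε : ℝ} {N : ℕ} {t : ℝ≥0} (h : OscillatesBelow (dyadicPath S) dyadics ε N t) :
    ∃ n₀, ∀ n ≥ n₀, ∀ j, t ≤ dyadic n j → OscillatesBelow (S n) univ ε N j := by
  induction N generalizing t with
  | zero => exact ⟨0, fun _ _ _ _ => trivial⟩
  | succ N ih =>
    obtain ⟨s, ⟨a, i, rfl⟩, s', ⟨a', i', rfl⟩, h1, h2, h3, h4⟩ := h
    obtain ⟨n₀, hn₀⟩ := ih h4
    refine ⟨max n₀ (max a a'), fun n hn j hj => ?_⟩
    obtain ⟨b, rfl⟩ : ∃ b, n = a + b := ⟨n - a, by omega⟩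
    obtain ⟨b', hb'⟩ : ∃ b', a + b = a' + b' := ⟨a + b - a', by omega⟩
    rw [dyadicPath_dyadic hS, dyadicPath_dyadic hS, ← eq_add_of_consistent hS a b,
      ← eq_add_of_consistent hS a' b', ← hb'] at h3
    rw [← dyadic_add a b, ← dyadic_add a' b', ← hb', (dyadic_strictMono _).lt_iff_lt] at h1
    rw [← dyadic_add a' b', ← hb'] at h2
    refine ⟨_, mem_univ _, _, mem_univ _, h1, ?_, h3, ?_⟩
    · exact (dyadic_strictMono _).le_iff_le.1 (h2.trans hj)
    · exact hn₀ _ (by omega) _ (dyadic_add a b i).ge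

/-- A consistent family of dyadic values whose levels have a bounded number of oscillations has
boundedly many oscillations along the set of all dyadic numbers. -/
theorem not_oscillatesBelow_dyadicPath {S : ℕ → ℕ → ℝ} (hS : ∀ n j, S (n + 1) (2 * j) = S n j)
    (hosc : ∀ m J : ℕ, ∃ N, ∀ n, ¬ OscillatesBelow (S n) univ (1 / ((m : ℝ) + 1)) N (2 ^ n * J))
    (ε : ℝ) (hε : 0 < ε) (T : ℝ≥0) : ∃ N, ¬ OscillatesBelow (dyadicPath S) dyadics ε N T := by
  obtain ⟨m, hm⟩ := exists_nat_one_div_lt hε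
  obtain ⟨J, hJ⟩ := exists_nat_ge T
  obtain ⟨N, hN⟩ := hosc m J
  refine ⟨N, fun h => ?_⟩
  have hmono : ∀ {N : ℕ} {t : ℝ≥0}, OscillatesBelow (dyadicPath S) dyadics ε N t →
      OscillatesBelow (dyadicPath S) dyadics (1 / ((m : ℝ) + 1)) N t := by
    intro N
    induction N with
    | zero => exact fun _ => trivial
    | succ N ih =>
      rintro t ⟨s, hs, s', hs', h1, h2, h3, h4⟩
      exact ⟨s, hs, s', hs', h1, h2, hm.trans h3, ih h4⟩
  obtain ⟨n₀, hn₀⟩ := (hmono h).exists_level hS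
  refine hN n₀ (hn₀ n₀ le_rfl _ (hJ.trans ?_))
  have := dyadic_add 0 n₀ J
  rw [zero_add] at this
  rw [this]
  simp [dyadic]

end Dyadic

/-! ### Inverse limits of laws -/

section InverseLimit

variable {F : ℕ → Type*} [∀ n, MeasurableSpace (F n)]

/-- A kernel that depends on `x` only through `g x` can be evaluated after mapping by `g`. -/
theorem map_prodMap_compProd_comap {α β γ : Type*} [MeasurableSpace α] [MeasurableSpace β]
    [MeasurableSpace γ] (ρ : Measure α) [SFinite ρ] {g : α → β} (hg : Measurable g)
    (K : Kernel β γ) [IsSFiniteKernel K] :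
    (ρ ⊗ₘ K.comap g hg).map (Prod.map g id) = (ρ.map g) ⊗ₘ K := by
  ext s hs
  rw [Measure.map_apply (hg.prodMap measurable_id) hs, Measure.compProd_apply hs,
    Measure.compProd_apply ((hg.prodMap measurable_id) hs),
    lintegral_map (Kernel.measurable_kernel_prodMk_left hs) hg]
  rfl

/-- A sequence of laws on standard Borel spaces that are images of each other under measurable
maps has an inverse limit: a Markov chain whose `n`-th step disintegrates the `(n+1)`-st law over
the `n`-th one. -/
theorem exists_inverseLimit [∀ n, StandardBorelSpace (F n)] [∀ n, Nonempty (F n)]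
    (μ : ∀ n, Measure (F n)) [∀ n, IsProbabilityMeasure (μ n)] (π : ∀ n, F (n + 1) → F n)
    (hπ : ∀ n, Measurable (π n)) (hμ : ∀ n, (μ (n + 1)).map (π n) = μ n) :
    ∃ P : Measure (∀ n, F n), IsProbabilityMeasure P ∧ (∀ n, P.map (fun x => x n) = μ n) ∧
      ∀ᵐ x ∂P, ∀ n, π n (x (n + 1)) = x n := by
  let K : ∀ n, Kernel (F n) (F (n + 1)) := fun n => condDistrib id (π n) (μ (n + 1))
  let κ : ∀ n, Kernel (∀ i : Finset.Iic n, F i) (F (n + 1)) := fun n =>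
    (K n).comap (fun x => x ⟨n, Finset.mem_Iic.2 le_rfl⟩) (measurable_pi_apply _)
  have hK : ∀ n, μ n ⊗ₘ K n = (μ (n + 1)).map (fun z => (π n z, z)) := by
    intro n
    have h : (μ (n + 1)).map (π n) ⊗ₘ condDistrib id (π n) (μ (n + 1))
        = (μ (n + 1)).map (fun z => (π n z, id z)) :=
      compProd_map_condDistrib measurable_id.aemeasurable
    rw [hμ] at h
    exact h
  let P : Measure (∀ n, F n) := Kernel.trajMeasure (μ 0) κ
  -- the Markov property of consecutive coordinates
  have hstep : ∀ n, P.map (fun x => x n) ⊗ₘ K n = P.map (fun x => (x n, x (n + 1))) := by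
    intro n
    have h := Kernel.map_frestrictLe_trajMeasure_compProd_eq_map_trajMeasure (μ₀ := μ 0) (κ := κ)
      (a := n)
    have h2 := congrArg (fun ρ => ρ.map (Prod.map
      (fun x : (∀ i : Finset.Iic n, F i) => x ⟨n, Finset.mem_Iic.2 le_rfl⟩) id)) h
    have hg : Measurable fun x : (∀ i : Finset.Iic n, F i) => x ⟨n, Finset.mem_Iic.2 le_rfl⟩ :=
      measurable_pi_apply _
    simp only [κ] at h2
    rw [map_prodMap_compProd_comap _ hg, Measure.map_map hg (by fun_prop),
      Measure.map_map (hg.prodMap measurable_id) (by fun_prop)] at h2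
    exact h2
  have hmarg : ∀ n, P.map (fun x => x n) = μ n := by
    intro n
    induction n with
    | zero =>
      have h : P.map (Preorder.frestrictLe 0) = (μ 0).map (MeasurableEquiv.piUnique _).symm := by
        simp only [P, Kernel.trajMeasure]
        rw [Measure.map_comp _ _ (by fun_prop), Kernel.traj_map_frestrictLe,
          Kernel.partialTraj_self, Measure.id_comp]
      ext s hs
      have hs' : MeasurableSet
          ((fun x : (∀ i : Finset.Iic 0, F i) => x ⟨0, Finset.mem_Iic.2 le_rfl⟩) ⁻¹' s) :=
        measurable_pi_apply (X := fun i : Finset.Iic 0 => F i) _ hs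
      have h2 := congrArg (fun ρ => ρ ((fun x : (∀ i : Finset.Iic 0, F i) =>
        x ⟨0, Finset.mem_Iic.2 le_rfl⟩) ⁻¹' s)) h
      rw [Measure.map_apply (by fun_prop) hs'] at h2
      rw [Measure.map_apply (by fun_prop) hs]
      exact h2.trans (MeasurableEquiv.map_apply _ _)
    | succ n ih =>
      have h := hstep n
      rw [ih, hK] at h
      have h2 := congrArg (fun ρ => ρ.map Prod.snd) h
      rw [Measure.map_map measurable_snd ((hπ n).prodMk measurable_id'),
        Measure.map_map measurable_snd (by fun_prop)] at h2
      refine h2.symm.trans ?_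
      exact Measure.map_id
  refine ⟨P, inferInstance, hmarg, ae_all_iff.2 fun n => ?_⟩
  have h := hstep n
  rw [hmarg, hK] at h
  have hm : MeasurableSet {w : F n × F (n + 1) | π n w.2 = w.1} :=
    measurableSet_eq_fun ((hπ n).comp measurable_snd) measurable_fst
  have hae : ∀ᵐ w ∂(P.map (fun x => (x n, x (n + 1)))), π n w.2 = w.1 := by
    rw [← h, ae_map_iff ((hπ n).prodMk measurable_id').aemeasurable hm]
    exact ae_of_all _ fun _ => rfl
  exact (ae_map_iff (by fun_prop) hm).1 hae

end InverseLimit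

/-! ### Independent increments over the dyadic grids -/

section Blocks

variable {E : Type*} [NormedAddCommGroup E] [InnerProductSpace ℝ E] [FiniteDimensional ℝ E]
  [MeasurableSpace E] [BorelSpace E]

/-- Sums over disjoint blocks of an i.i.d. sequence with law `ν c` in a convolution semigroup are
independent with laws given by the semigroup. -/
theorem map_blockSum_infinitePi {ν : ℝ≥0 → Measure E} [∀ t, IsProbabilityMeasure (ν t)]
    {Ψ : E → ℂ} (hν : ∀ (t : ℝ≥0) ξ, charFun (ν t) ξ = Complex.exp (-(((t : ℝ) : ℂ) * Ψ ξ)))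
    (c : ℝ≥0) {a : ℕ → ℕ} (ha : Monotone a) :
    (Measure.infinitePi fun _ : ℕ => ν c).map
        (fun z l => ∑ i ∈ Finset.Ico (a l) (a (l + 1)), z i)
      = Measure.infinitePi fun l => ν (((a (l + 1) - a l : ℕ) : ℝ≥0) * c) := by
  -- the numbering of the summands by block and position within the block
  let f : (Σ l : ℕ, Fin (a (l + 1) - a l)) → ℕ := fun p => a p.1 + p.2
  have hf : Function.Injective f := by
    rintro ⟨l, b⟩ ⟨l', b'⟩ h
    have hlt : ∀ {l l' : ℕ} (b : Fin (a (l + 1) - a l)) (b' : Fin (a (l' + 1) - a l')),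
        a l + b = a l' + b' → ¬ l < l' := by
      intro l l' b b' h hll
      have h1 : a (l + 1) ≤ a l' := ha hll
      have h2 := b.2
      omega
    have hl : l = l' := le_antisymm (not_lt.1 (hlt b' b h.symm)) (not_lt.1 (hlt b b' h))
    subst hl
    have : (b : ℕ) = b' := by simpa [f] using h
    rw [Fin.ext this]
  have hblock : ∀ l, (Measure.infinitePi fun _ : Fin (a (l + 1) - a l) => ν c).map
      (fun w => ∑ b, w b) = ν (((a (l + 1) - a l : ℕ) : ℝ≥0) * c) := by
    intro l
    have hm : Measurable fun w : Fin (a (l + 1) - a l) → E => ∑ b, w b := by fun_prop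
    have := Measure.isProbabilityMeasure_map (μ := Measure.infinitePi
      fun _ : Fin (a (l + 1) - a l) => ν c) hm.aemeasurable
    refine Measure.ext_of_charFun (funext fun ξ => ?_)
    rw [Measure.infinitePi_eq_pi, charFun_map_sum_pi_eq_prod]
    simp only [Finset.prod_const, Finset.card_univ, Fintype.card_fin, Pi.pow_apply, hν]
    rw [← Complex.exp_nat_mul]
    congr 1
    generalize a (l + 1) - a l = m
    push_cast
    ring
  have h1 := Measure.map_infinitePi_infinitePi_of_inj (P := fun _ : ℕ => ν c) hf
  have h2 := Measure.infinitePi_map_piCurry (X := fun (l : ℕ) (_ : Fin (a (l + 1) - a l)) => E)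
    (fun _ _ => ν c)
  have h3 := Measure.infinitePi_map_pi
    (μ := fun l : ℕ => Measure.infinitePi fun _ : Fin (a (l + 1) - a l) => ν c)
    (f := fun l w => ∑ b, w b) (fun l => by fun_prop)
  simp only [hblock] at h3
  rw [← h3, ← h2, ← h1, Measure.map_map (by fun_prop) (by fun_prop),
    Measure.map_map (by fun_prop) (by fun_prop)]
  congr 1
  ext z l
  simp only [Function.comp_apply, MeasurableEquiv.coe_piCurry, Sigma.curry, f]
  rw [Finset.sum_Ico_eq_sum_range, Finset.sum_range]

theorem sum_range_two_mul {M : Type*} [AddCommMonoid M] (z : ℕ → M) (j : ℕ) :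
    ∑ i ∈ Finset.range (2 * j), z i
      = ∑ l ∈ Finset.range j, ∑ i ∈ Finset.Ico (2 * l) (2 * (l + 1)), z i := by
  induction j with
  | zero => simp
  | succ j ih =>
    rw [Finset.sum_range_succ, ← ih, Finset.range_eq_Ico, Finset.range_eq_Ico]
    exact (Finset.sum_Ico_consecutive z (Nat.zero_le _) (by omega)).symm

/-- A convolution semigroup is realized by a family of i.i.d. increments over all dyadic grids,
each grid refining the previous one. -/
theorem exists_dyadic_increments {ν : ℝ≥0 → Measure E} [∀ t, IsProbabilityMeasure (ν t)]
    {Ψ : E → ℂ} (hν : ∀ (t : ℝ≥0) ξ, charFun (ν t) ξ = Complex.exp (-(((t : ℝ) : ℂ) * Ψ ξ))) :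
    ∃ P : Measure (ℕ → ℕ → E), IsProbabilityMeasure P ∧
      (∀ n, P.map (fun x => x n) = Measure.infinitePi fun _ : ℕ => ν (dyadic n 1)) ∧
      ∀ᵐ x ∂P, ∀ n j, ∑ i ∈ Finset.range (2 * j), x (n + 1) i = ∑ i ∈ Finset.range j, x n i := by
  obtain ⟨P, hP, h1, h2⟩ := exists_inverseLimit (F := fun _ => ℕ → E)
    (fun n => Measure.infinitePi fun _ : ℕ => ν (dyadic n 1))
    (fun _ z l => ∑ i ∈ Finset.Ico (2 * l) (2 * (l + 1)), z i) (fun n => by fun_prop) (by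
      intro n
      rw [map_blockSum_infinitePi hν _ (a := fun l => 2 * l) (fun a b hab => by simpa using hab)]
      congr 1
      ext1 l
      congr 1
      rw [show 2 * (l + 1) - 2 * l = 2 by omega]
      simp only [dyadic, pow_succ]
      push_cast
      field_simp)
  refine ⟨P, hP, h1, ?_⟩
  filter_upwards [h2] with x hx n j
  rw [sum_range_two_mul]
  exact Finset.sum_congr rfl fun l _ => congrFun (hx n) l

end Blocks

/-! ### Boundedness of oscillations depends only on the increment laws -/

section OscillationTransfer

/-- Two decreasing limits of increasing limits of events have the same measure as soon as the
events do. -/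
theorem measure_iInter_iUnion_congr {Ω₁ Ω₂ : Type*} [MeasurableSpace Ω₁] [MeasurableSpace Ω₂]
    {P₁ : Measure Ω₁} {P₂ : Measure Ω₂} [IsFiniteMeasure P₁] [IsFiniteMeasure P₂]
    {U : ℕ → ℕ → Set Ω₁} {V : ℕ → ℕ → Set Ω₂}
    (hU : ∀ n N, NullMeasurableSet (U n N) P₁) (hV : ∀ n N, NullMeasurableSet (V n N) P₂)
    (hUmono : ∀ N, Monotone fun n => U n N) (hVmono : ∀ N, Monotone fun n => V n N)
    (hUanti : ∀ n, Antitone (U n)) (hVanti : ∀ n, Antitone (V n))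
    (h : ∀ n N, P₁ (U n N) = P₂ (V n N)) :
    P₁ (⋂ N, ⋃ n, U n N) = P₂ (⋂ N, ⋃ n, V n N) := by
  have hU' : Antitone fun N => ⋃ n, U n N := fun N M hNM => iUnion_mono fun n => hUanti n hNM
  have hV' : Antitone fun N => ⋃ n, V n N := fun N M hNM => iUnion_mono fun n => hVanti n hNM
  rw [hU'.measure_iInter (fun N => .iUnion fun n => hU n N) ⟨0, measure_ne_top _ _⟩,
    hV'.measure_iInter (fun N => .iUnion fun n => hV n N) ⟨0, measure_ne_top _ _⟩]
  simp only [(hUmono _).measure_iUnion, (hVmono _).measure_iUnion, h]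

variable {Ω Ω' : Type*} [MeasurableSpace Ω] [MeasurableSpace Ω']

/-- The increments over a dyadic grid of a process with independent and stationary increments are
i.i.d. -/
theorem map_dyadic_increments {P' : Measure Ω'} {W : ℝ≥0 → Ω' → ℝ} (hW : ∀ t, Measurable (W t))
    (hindep : HasIndepIncrements W P') {ρ : ℝ≥0 → Measure ℝ}
    (hlaw : ∀ s h, P'.map (fun ω => W (s + h) ω - W s ω) = ρ h) (n : ℕ) :
    P'.map (fun ω j => W (dyadic n (j + 1)) ω - W (dyadic n j) ω)
      = Measure.infinitePi fun _ : ℕ => ρ (dyadic n 1) := by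
  have h := hindep.nat (dyadic_strictMono n).monotone
  rw [h.map_fun_eq_infinitePi_map (fun i => by fun_prop)]
  congr 1
  ext1 j
  have : dyadic n (j + 1) = dyadic n j + dyadic n 1 := by
    simp [dyadic, add_div]
  rw [this]
  exact hlaw _ _

/-- The number of oscillations over the dyadic grids depends only on the laws of the increments,
so it is bounded as soon as a process with the same increments has càdlàg paths. -/
theorem ae_exists_not_oscillatesBelow {P : Measure Ω} [IsProbabilityMeasure P]
    {P' : Measure Ω'} [IsProbabilityMeasure P'] {W : ℝ≥0 → Ω' → ℝ} (hW : ∀ t, Measurable (W t))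
    (hindep : HasIndepIncrements W P') {ρ : ℝ≥0 → Measure ℝ}
    (hlaw : ∀ s h, P'.map (fun ω => W (s + h) ω - W s ω) = ρ h)
    (hcadlag : ∀ᵐ ω ∂P', ∀ t, ContinuousWithinAt (fun s => W s ω) (Ici t) t ∧
      ∃ l, Tendsto (fun s => W s ω) (𝓝[<] t) (𝓝 l))
    {z : ℕ → ℕ → Ω → ℝ} (hz : ∀ n j, Measurable (z n j))
    (hzlaw : ∀ n, P.map (fun ω j => z n j ω) = Measure.infinitePi fun _ : ℕ => ρ (dyadic n 1))
    (hcons : ∀ᵐ ω ∂P, ∀ n j,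
      ∑ i ∈ Finset.range (2 * j), z (n + 1) i ω = ∑ i ∈ Finset.range j, z n i ω) :
    ∀ᵐ ω ∂P, ∀ m J : ℕ, ∃ N, ∀ n, ¬ OscillatesBelow (fun j => ∑ i ∈ Finset.range j, z n i ω) univ
      (1 / ((m : ℝ) + 1)) N (2 ^ n * J) := by
  refine ae_all_iff.2 fun m => ae_all_iff.2 fun J => ?_
  set ε : ℝ := 1 / ((m : ℝ) + 1) with hεdef
  have hε : 0 < ε := by positivity
  set C : Set Ω := {ω | ∀ n j,
    ∑ i ∈ Finset.range (2 * j), z (n + 1) i ω = ∑ i ∈ Finset.range j, z n i ω} with hC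
  have hC0 : P Cᶜ = 0 := hcons
  have hCm : NullMeasurableSet C P := by
    have := (NullMeasurableSet.of_null hC0).compl
    rwa [compl_compl] at this
  let A : ℕ → ℕ → Set (ℕ → ℝ) := fun n N =>
    {w | OscillatesBelow (fun j => ∑ i ∈ Finset.range j, w i) univ ε N (2 ^ n * J)}
  have hA : ∀ n N, MeasurableSet (A n N) := fun n N =>
    measurableSet_oscillatesBelow (f := fun j (w : ℕ → ℝ) => ∑ i ∈ Finset.range j, w i)
      (fun j => by fun_prop) ε N _
  -- on the set `C` of consistent families the number of oscillations increases with the level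
  let U : ℕ → ℕ → Set Ω := fun n N => (fun ω j => z n j ω) ⁻¹' A n N ∩ C
  let V : ℕ → ℕ → Set Ω' := fun n N =>
    {ω | OscillatesBelow (fun j => W (dyadic n j) ω) univ ε N (2 ^ n * J)}
  have hzm : ∀ n, Measurable fun ω j => z n j ω := fun n => measurable_pi_iff.2 (hz n)
  have hWm : ∀ n, Measurable fun ω j => W (dyadic n (j + 1)) ω - W (dyadic n j) ω := fun n =>
    measurable_pi_iff.2 fun j => (hW _).sub (hW _)
  have hVA : ∀ n N, V n N
      = (fun ω j => W (dyadic n (j + 1)) ω - W (dyadic n j) ω) ⁻¹' A n N := by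
    intro n N
    ext ω
    simp only [V, A, mem_preimage, Set.mem_ofPred_eq]
    have : ∀ j, ∑ i ∈ Finset.range j, (W (dyadic n (i + 1)) ω - W (dyadic n i) ω)
        = W (dyadic n j) ω + -W (dyadic n 0) ω := fun j => by
      rw [Finset.sum_range_sub (fun i => W (dyadic n i) ω), sub_eq_add_neg]
    simp only [this]
    rw [oscillatesBelow_add_const]
  have h2mul : StrictMono fun j : ℕ => 2 * j := fun a b hab => by simpa using hab
  have hUmono : ∀ N, Monotone fun n => U n N := by
    intro N
    refine monotone_nat_of_le_succ fun n ω hω => ⟨?_, hω.2⟩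
    have h1 : OscillatesBelow (fun j => ∑ i ∈ Finset.range (2 * j), z (n + 1) i ω) univ ε N
        (2 ^ n * J) := by
      have : (fun j => ∑ i ∈ Finset.range (2 * j), z (n + 1) i ω)
          = fun j => ∑ i ∈ Finset.range j, z n i ω := funext fun j => hω.2 n j
      rw [this]
      exact hω.1
    have h2 := OscillatesBelow.of_comp (f := fun j => ∑ i ∈ Finset.range j, z (n + 1) i ω) h2mul h1
    simp only [← mul_assoc, ← pow_succ'] at h2
    exact h2
  have hVmono : ∀ N, Monotone fun n => V n N := by
    intro N
    refine monotone_nat_of_le_succ fun n ω hω => ?_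
    have h1 : OscillatesBelow (fun j => W (dyadic (n + 1) (2 * j)) ω) univ ε N (2 ^ n * J) := by
      have : (fun j => W (dyadic (n + 1) (2 * j)) ω) = fun j => W (dyadic n j) ω :=
        funext fun j => by rw [← dyadic_add n 1 j, pow_one]
      rw [this]
      exact hω
    have h2 := OscillatesBelow.of_comp (f := fun j => W (dyadic (n + 1) j) ω) h2mul h1
    simp only [← mul_assoc, ← pow_succ'] at h2
    exact h2
  have hzero : P' (⋂ N, ⋃ n, V n N) = 0 := by
    refine measure_mono_null (fun ω hω => ?_) hcadlag
    intro hcad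
    obtain ⟨N, hN⟩ := exists_not_oscillatesBelow_of_cadlag hcad hε (dyadic 0 J)
    obtain ⟨n, hn⟩ := mem_iUnion.1 (mem_iInter.1 hω N)
    have h1 := OscillatesBelow.of_comp (f := fun s => W s ω) (dyadic_strictMono n) hn
    have h2 := dyadic_add 0 n J
    rw [zero_add] at h2
    rw [h2] at h1
    exact hN h1
  have hUzero : P (⋂ N, ⋃ n, U n N) = 0 := by
    rw [← hzero]
    refine measure_iInter_iUnion_congr
      (fun n N => ((hzm n) (hA n N)).nullMeasurableSet.inter hCm)
      (fun n N => by
        rw [hVA]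
        exact ((hWm n) (hA n N)).nullMeasurableSet) hUmono hVmono
      (fun n N M hNM ω hω => ⟨OscillatesBelow.anti hω.1 hNM, hω.2⟩)
      (fun n N M hNM ω hω => OscillatesBelow.anti hω hNM) (fun n N => ?_)
    rw [hVA, ← Measure.map_apply (hWm n) (hA n N), map_dyadic_increments hW hindep hlaw, ← hzlaw,
      Measure.map_apply (hzm n) (hA n N)]
    exact measure_inter_conull hC0
  have hae : ∀ᵐ ω ∂P, ω ∉ ⋂ N, ⋃ n, U n N := measure_eq_zero_iff_ae_notMem.1 hUzero
  filter_upwards [hae, hcons] with ω hω hωC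
  simp only [mem_iInter, mem_iUnion, not_forall, not_exists] at hω
  obtain ⟨N, hN⟩ := hω
  exact ⟨N, fun n hn => hN n ⟨hn, hωC⟩⟩

end OscillationTransfer

/-! ### Càdlàg extension of dyadic values -/

section Paths

variable {d : ℕ}

theorem dyadicPath_apply (S : ℕ → ℕ → EuclideanSpace ℝ (Fin d)) (c : Fin d) (t : ℝ≥0) :
    dyadicPath S t c = dyadicPath (fun n j => S n j c) t := by
  unfold dyadicPath
  split_ifs <;> rfl

theorem EuclideanSpace.exists_tendsto_of_forall_apply {α : Type*} {l : Filter α}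
    {f : α → EuclideanSpace ℝ (Fin d)} (h : ∀ c, ∃ y, Tendsto (fun a => f a c) l (𝓝 y)) :
    ∃ y, Tendsto f l (𝓝 y) := by
  choose y hy using h
  exact ⟨WithLp.toLp 2 y, ((PiLp.continuous_toLp 2 _).tendsto y).comp (tendsto_pi_nhds.2 hy)⟩

/-- Dyadic values with boundedly many oscillations extend to a càdlàg path. -/
theorem exists_cadlag_of_not_oscillatesBelow {S : ℕ → ℕ → EuclideanSpace ℝ (Fin d)}
    (hS : ∀ n j, S (n + 1) (2 * j) = S n j)
    (hosc : ∀ c, ∀ m J : ℕ, ∃ N, ∀ n,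
      ¬ OscillatesBelow (fun j => S n j c) univ (1 / ((m : ℝ) + 1)) N (2 ^ n * J)) :
    ∃ G : ℝ≥0 → EuclideanSpace ℝ (Fin d),
      (∀ t, ContinuousWithinAt G (Ici t) t ∧ ∃ l, Tendsto G (𝓝[<] t) (𝓝 l)) ∧
      ∀ t, Tendsto (fun n => S n (dyadicAbove n t)) atTop (𝓝 (G t)) := by
  have hbd : ∀ c, ∀ ε > 0, ∀ T, ∃ N,
      ¬ OscillatesBelow (fun t => dyadicPath S t c) dyadics ε N T := by
    intro c
    simp only [dyadicPath_apply]
    exact not_oscillatesBelow_dyadicPath (fun n j => by rw [hS]) (hosc c)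
  have hR : ∀ t, ∃ y, Tendsto (dyadicPath S) (𝓝[dyadics ∩ Ioi t] t) (𝓝 y) := fun t =>
    EuclideanSpace.exists_tendsto_of_forall_apply fun c =>
      exists_tendsto_nhdsGT_of_not_oscillatesBelow (hbd c) t
  choose G hG using hR
  refine ⟨G, fun t => ⟨continuousWithinAt_of_tendsto_nhdsGT neBot_nhdsWithin_dyadics_Ioi hG t, ?_⟩,
    fun t => ?_⟩
  · obtain ⟨l, hl⟩ := EuclideanSpace.exists_tendsto_of_forall_apply fun c =>
      exists_tendsto_nhdsLT_of_not_oscillatesBelow (hbd c) t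
    exact ⟨l, tendsto_nhdsLT_of_tendsto_nhdsGT neBot_nhdsWithin_dyadics_Ioi hG hl⟩
  · have := (hG t).comp (tendsto_dyadic_dyadicAbove_nhdsWithin t)
    refine this.congr fun n => ?_
    exact dyadicPath_dyadic hS _ _

end Paths

/-! ### Almost sure limits of laws -/

section Limits

variable {Ω : Type*} [MeasurableSpace Ω] {P : Measure Ω} [IsProbabilityMeasure P]

theorem tendsto_charFun_map_of_ae_tendsto {E : Type*} [NormedAddCommGroup E]
    [InnerProductSpace ℝ E] [MeasurableSpace E] [BorelSpace E] [SecondCountableTopology E]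
    {X : Ω → E} {Z : ℕ → Ω → E} (hX : Measurable X) (hZ : ∀ n, Measurable (Z n))
    (h : ∀ᵐ ω ∂P, Tendsto (fun n => Z n ω) atTop (𝓝 (X ω))) (ξ : E) :
    Tendsto (fun n => charFun (P.map (Z n)) ξ) atTop (𝓝 (charFun (P.map X) ξ)) := by
  have hc : Continuous fun x : E => Complex.exp ((inner ℝ x ξ : ℝ) * Complex.I) := by fun_prop
  simp only [charFun_apply]
  rw [integral_map hX.aemeasurable hc.aestronglyMeasurable]
  simp only [fun n => integral_map (μ := P) (hZ n).aemeasurable hc.aestronglyMeasurable]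
  refine tendsto_integral_of_dominated_convergence (fun _ => 1)
    (fun n => (hc.measurable.comp (hZ n)).aestronglyMeasurable) (integrable_const _)
    (fun n => ae_of_all _ fun ω => ?_) ?_
  · rw [Complex.norm_exp_ofReal_mul_I]
  · filter_upwards [h] with ω hω
    exact (hc.tendsto _).comp hω

/-- Independence is preserved under almost sure limits. -/
theorem iIndepFun_of_ae_tendsto {ι : Type*} [Fintype ι] {E : Type*} [NormedAddCommGroup E]
    [InnerProductSpace ℝ E] [MeasurableSpace E] [BorelSpace E] [SecondCountableTopology E]
    [CompleteSpace E] {X : ι → Ω → E} {Z : ℕ → ι → Ω → E} (hX : ∀ i, Measurable (X i))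
    (hZ : ∀ n i, Measurable (Z n i)) (hindep : ∀ n, iIndepFun (Z n) P)
    (h : ∀ i, ∀ᵐ ω ∂P, Tendsto (fun n => Z n i ω) atTop (𝓝 (X i ω))) : iIndepFun X P := by
  rw [iIndepFun_iff_charFun_pi fun i => (hX i).aemeasurable]
  intro ξ
  have h1 := fun n => (iIndepFun_iff_charFun_pi fun i => (hZ n i).aemeasurable).1 (hindep n) ξ
  have h2 : Tendsto (fun n => charFun (P.map fun ω => WithLp.toLp 2 fun i => Z n i ω) ξ) atTop
      (𝓝 (charFun (P.map fun ω => WithLp.toLp 2 fun i => X i ω) ξ)) := by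
    refine tendsto_charFun_map_of_ae_tendsto ?_ (fun n => ?_) ?_ ξ
    · exact (PiLp.continuous_toLp 2 _).measurable.comp (measurable_pi_iff.2 hX)
    · exact (PiLp.continuous_toLp 2 _).measurable.comp (measurable_pi_iff.2 (hZ n))
    · filter_upwards [ae_all_iff.2 h] with ω hω
      exact ((PiLp.continuous_toLp 2 _).tendsto _).comp (tendsto_pi_nhds.2 hω)
  have h3 : Tendsto (fun n => ∏ i, charFun (P.map (Z n i)) (ξ i)) atTop
      (𝓝 (∏ i, charFun (P.map (X i)) (ξ i))) :=
    tendsto_finsetProd _ fun i _ =>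
      tendsto_charFun_map_of_ae_tendsto (hX i) (fun n => hZ n i) (h i) (ξ i)
  simp only [h1] at h2
  exact tendsto_nhds_unique h2 h3

end Limits

/-! ### Lévy processes from convolution semigroups -/

section Existence

variable {E : Type*} [NormedAddCommGroup E] [InnerProductSpace ℝ E] [FiniteDimensional ℝ E]
  [MeasurableSpace E] [BorelSpace E]

/-- Increments of the partial sums at level `n` over successive blocks of the grid are independent,
with laws given by the semigroup. -/
theorem map_blockIncrement {P : Measure (ℕ → ℕ → E)} {ν : ℝ≥0 → Measure E}
    [∀ t, IsProbabilityMeasure (ν t)] {Ψ : E → ℂ}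
    (hν : ∀ (t : ℝ≥0) ξ, charFun (ν t) ξ = Complex.exp (-(((t : ℝ) : ℂ) * Ψ ξ))) {n : ℕ}
    (hP : P.map (fun x => x n) = Measure.infinitePi fun _ : ℕ => ν (dyadic n 1))
    {a : ℕ → ℕ} (ha : Monotone a) :
    P.map (fun x l => ∑ i ∈ Finset.range (a (l + 1)), x n i - ∑ i ∈ Finset.range (a l), x n i)
      = Measure.infinitePi fun l => ν (((a (l + 1) - a l : ℕ) : ℝ≥0) * dyadic n 1) := by
  rw [← map_blockSum_infinitePi hν _ ha, ← hP, Measure.map_map (by fun_prop) (by fun_prop)]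
  congr 1
  ext x l
  simp only [Function.comp_apply]
  rw [Finset.sum_Ico_eq_sub _ (ha (Nat.le_succ l))]

theorem iIndepFun_blockIncrement {P : Measure (ℕ → ℕ → E)} [IsProbabilityMeasure P]
    {ν : ℝ≥0 → Measure E} [∀ t, IsProbabilityMeasure (ν t)] {Ψ : E → ℂ}
    (hν : ∀ (t : ℝ≥0) ξ, charFun (ν t) ξ = Complex.exp (-(((t : ℝ) : ℂ) * Ψ ξ))) {n : ℕ}
    (hP : P.map (fun x => x n) = Measure.infinitePi fun _ : ℕ => ν (dyadic n 1))
    {a : ℕ → ℕ} (ha : Monotone a) :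
    iIndepFun (fun l (x : ℕ → ℕ → E) =>
      ∑ i ∈ Finset.range (a (l + 1)), x n i - ∑ i ∈ Finset.range (a l), x n i) P := by
  have h := map_blockIncrement hν hP ha
  rw [iIndepFun_iff_map_fun_eq_infinitePi_map (fun i => by fun_prop), h]
  congr 1
  ext1 l
  have h2 := congrArg (fun ρ => ρ.map fun w => w l) h
  rw [Measure.infinitePi_map_eval, Measure.map_map (by fun_prop) (by fun_prop)] at h2
  exact h2.symm

theorem charFun_map_dyadicIncrement {P : Measure (ℕ → ℕ → E)} {ν : ℝ≥0 → Measure E}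
    [∀ t, IsProbabilityMeasure (ν t)] {Ψ : E → ℂ}
    (hν : ∀ (t : ℝ≥0) ξ, charFun (ν t) ξ = Complex.exp (-(((t : ℝ) : ℂ) * Ψ ξ))) {n : ℕ}
    (hP : P.map (fun x => x n) = Measure.infinitePi fun _ : ℕ => ν (dyadic n 1))
    {a b : ℕ} (hab : a ≤ b) (ξ : E) :
    charFun (P.map fun x => ∑ i ∈ Finset.range b, x n i - ∑ i ∈ Finset.range a, x n i) ξ
      = Complex.exp (-((((dyadic n b : ℝ) - dyadic n a : ℝ) : ℂ) * Ψ ξ)) := by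
  -- the increment is the first one along the grid points `a, b, b, …`
  have hmono : Monotone fun l : ℕ => if l = 0 then a else b :=
    monotone_nat_of_le_succ fun l => by
      rcases eq_or_ne l 0 with rfl | hl
      · simpa using hab
      · simp [hl]
  have h2 := congrArg (fun ρ => ρ.map fun w => w 0) (map_blockIncrement hν hP hmono)
  rw [Measure.infinitePi_map_eval, Measure.map_map (by fun_prop) (by fun_prop)] at h2
  have h3 : P.map (fun x => ∑ i ∈ Finset.range b, x n i - ∑ i ∈ Finset.range a, x n i)
      = ν (((b - a : ℕ) : ℝ≥0) * dyadic n 1) := h2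
  rw [h3, hν]
  congr 3
  norm_cast
  simp only [dyadic, NNReal.coe_mul, NNReal.coe_div, NNReal.coe_natCast, NNReal.coe_pow,
    Nat.cast_sub hab]
  push_cast
  ring

/-- A convolution semigroup on `ℝᵈ` whose one-dimensional marginals are the increment laws of some
process with independent increments and càdlàg paths is realized by a Lévy process. -/
theorem existsLevyProcess_of_semigroup {d : ℕ} {Ψ : EuclideanSpace ℝ (Fin d) → ℂ}
    {ν : ℝ≥0 → Measure (EuclideanSpace ℝ (Fin d))} [∀ t, IsProbabilityMeasure (ν t)]
    (hν : ∀ (t : ℝ≥0) ξ, charFun (ν t) ξ = Complex.exp (-(((t : ℝ) : ℂ) * Ψ ξ)))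
    {Ω' : Type*} [MeasurableSpace Ω'] {P' : Measure Ω'} [IsProbabilityMeasure P']
    {W : ℝ≥0 → Ω' → ℝ} (hW : ∀ t, Measurable (W t)) (hindep : HasIndepIncrements W P')
    (hcadlag : ∀ᵐ ω ∂P', ∀ t, ContinuousWithinAt (fun s => W s ω) (Ici t) t ∧
      ∃ l, Tendsto (fun s => W s ω) (𝓝[<] t) (𝓝 l))
    {ρ : ℝ≥0 → Measure ℝ} (hlaw : ∀ s h, P'.map (fun ω => W (s + h) ω - W s ω) = ρ h)
    (hρ : ∀ c h, (ν h).map (fun x => x c) = ρ h) : ExistsLevyProcess d Ψ := by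
  obtain ⟨P, hP, hPlaw, hcons⟩ := exists_dyadic_increments hν
  set S : (ℕ → ℕ → EuclideanSpace ℝ (Fin d)) → ℕ → ℕ → EuclideanSpace ℝ (Fin d) :=
    fun x n j => ∑ i ∈ Finset.range j, x n i with hSdef
  have hSm : ∀ n j, Measurable fun x => S x n j := fun n j => by fun_prop
  have hSapply : ∀ x n j c, S x n j c = ∑ i ∈ Finset.range j, x n i c := fun x n j c => by
    simp [hSdef]
  -- each coordinate has the increment laws of `W`
  have hosc : ∀ᵐ x ∂P, ∀ c, ∀ m J : ℕ, ∃ N, ∀ n,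
      ¬ OscillatesBelow (fun j => S x n j c) univ (1 / ((m : ℝ) + 1)) N (2 ^ n * J) := by
    refine ae_all_iff.2 fun c => ?_
    simp only [hSapply]
    refine ae_exists_not_oscillatesBelow
      (z := fun n j (x : ℕ → ℕ → EuclideanSpace ℝ (Fin d)) => x n j c) hW hindep hlaw hcadlag
      (fun n j => by fun_prop) (fun n => ?_) ?_
    · have := Measure.infinitePi_map_pi (μ := fun _ : ℕ => ν (dyadic n 1))
        (f := fun _ x => x c) (fun _ => by fun_prop)
      simp only [hρ] at this
      rw [← this, ← hPlaw, Measure.map_map (by fun_prop) (by fun_prop)]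
      rfl
    · filter_upwards [hcons] with x hx n j
      rw [← hSapply, ← hSapply]
      simp only [hSdef]
      rw [hx]
  -- outside a measurable null set the dyadic values extend to càdlàg paths
  have hgood : ∀ᵐ x ∂P, ∃ G : ℝ≥0 → EuclideanSpace ℝ (Fin d),
      (∀ t, ContinuousWithinAt G (Ici t) t ∧ ∃ l, Tendsto G (𝓝[<] t) (𝓝 l)) ∧
      ∀ t, Tendsto (fun n => S x n (dyadicAbove n t)) atTop (𝓝 (G t)) := by
    filter_upwards [hosc, hcons] with x hx hxc
    exact exists_cadlag_of_not_oscillatesBelow hxc hx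
  obtain ⟨B, hBsub, hBm, hB0⟩ := exists_measurable_superset_of_null (ae_iff.1 hgood)
  have hBc : ∀ᵐ x ∂P, x ∉ B := measure_eq_zero_iff_ae_notMem.1 hB0
  have hG : ∀ x, ∃ G : ℝ≥0 → EuclideanSpace ℝ (Fin d),
      (∀ t, ContinuousWithinAt G (Ici t) t ∧ ∃ l, Tendsto G (𝓝[<] t) (𝓝 l)) ∧
      ∀ t, Tendsto (fun n => Bᶜ.indicator (fun x => S x n (dyadicAbove n t)) x) atTop
        (𝓝 (G t)) := by
    intro x
    by_cases hx : x ∈ B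
    · refine ⟨fun _ => 0, fun t => ⟨continuousWithinAt_const, 0, tendsto_const_nhds⟩, fun t => ?_⟩
      simp [hx]
    · obtain ⟨G, hG1, hG2⟩ := not_not.1 fun h => hx (hBsub h)
      exact ⟨G, hG1, fun t => by simpa [hx] using hG2 t⟩
  choose Y hYcadlag hYlim using hG
  have hYm : ∀ t, Measurable fun x => Y x t := fun t =>
    measurable_of_tendsto_metrizable (fun n => (hSm n _).indicator hBm.compl)
      (tendsto_pi_nhds.2 fun x => hYlim x t)
  have hYae : ∀ t, ∀ᵐ x ∂P, Tendsto (fun n => S x n (dyadicAbove n t)) atTop (𝓝 (Y x t)) := by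
    intro t
    filter_upwards [hBc] with x hx
    simpa [hx] using hYlim x t
  have hdy : ∀ t : ℝ≥0, Tendsto (fun n => (dyadic n (dyadicAbove n t) : ℝ)) atTop (𝓝 (t : ℝ)) :=
    fun t => NNReal.tendsto_coe.2 (tendsto_dyadic_dyadicAbove t)
  have hexp : ∀ (ξ : EuclideanSpace ℝ (Fin d)) {u : ℕ → ℝ} {s : ℝ}, Tendsto u atTop (𝓝 s) →
      Tendsto (fun n => Complex.exp (-((u n : ℂ) * Ψ ξ))) atTop
        (𝓝 (Complex.exp (-((s : ℂ) * Ψ ξ)))) := by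
    intro ξ u s hu
    have : Continuous fun r : ℝ => Complex.exp (-((r : ℂ) * Ψ ξ)) := by fun_prop
    exact (this.tendsto s).comp hu
  -- the increments of `Y` are limits of increments over dyadic blocks of length tending to `h`
  have hincr : ∀ s h ξ, charFun (P.map fun x => Y x (s + h) - Y x s) ξ
      = Complex.exp (-(((h : ℝ) : ℂ) * Ψ ξ)) := by
    intro s h ξ
    have h1 := tendsto_charFun_map_of_ae_tendsto (P := P) (X := fun x => Y x (s + h) - Y x s)
      (Z := fun n x => S x n (dyadicAbove n (s + h)) - S x n (dyadicAbove n s))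
      ((hYm _).sub (hYm _)) (fun n => (hSm _ _).sub (hSm _ _)) (by
        filter_upwards [hYae (s + h), hYae s] with x hx1 hx2 using hx1.sub hx2) ξ
    refine tendsto_nhds_unique h1 ?_
    simp only [hSdef]
    simp only [fun n => charFun_map_dyadicIncrement hν (hPlaw n)
      (dyadicAbove_mono n (le_self_add : s ≤ s + h)) ξ]
    refine hexp ξ ?_
    have := (hdy (s + h)).sub (hdy s)
    rwa [NNReal.coe_add, add_sub_cancel_left] at this
  have hmarg : ∀ t ξ, charFun (P.map fun x => Y x t) ξ
      = Complex.exp (-(((t : ℝ) : ℂ) * Ψ ξ)) := by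
    intro t ξ
    have h1 := tendsto_charFun_map_of_ae_tendsto (P := P) (hYm t) (fun n => hSm n _) (hYae t) ξ
    refine tendsto_nhds_unique h1 ?_
    have h2 := fun n => charFun_map_dyadicIncrement hν (hPlaw n) (Nat.zero_le (dyadicAbove n t)) ξ
    simp only [Finset.range_zero, Finset.sum_empty, sub_zero, dyadic_zero, NNReal.coe_zero] at h2
    simp only [hSdef]
    simp only [h2]
    exact hexp ξ (hdy t)
  refine ⟨ℕ → ℕ → EuclideanSpace ℝ (Fin d), inferInstance, P, fun t x => Y x t, hP,
    ⟨hYm, ?_, ?_, ?_, ae_of_all _ hYcadlag⟩, hmarg⟩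
  · have h0 : P.map (fun x => Y x 0) = Measure.dirac 0 := by
      have := Measure.isProbabilityMeasure_map (μ := P) (hYm 0).aemeasurable
      refine Measure.ext_of_charFun (funext fun ξ => ?_)
      rw [hmarg, charFun_dirac]
      simp
    have h1 : ∀ᵐ y ∂(P.map fun x => Y x 0), y = 0 := by
      rw [h0, ae_dirac_eq]; rfl
    exact ae_of_ae_map (hYm 0).aemeasurable h1
  · rw [hasIndepIncrements_iff_nat]
    intro t ht
    rw [iIndepFun_iff_finset]
    intro s
    refine iIndepFun_of_ae_tendsto
      (Z := fun n (i : s) x => S x n (dyadicAbove n (t (i + 1))) - S x n (dyadicAbove n (t i)))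
      (fun i => (hYm _).sub (hYm _)) (fun n i => (hSm _ _).sub (hSm _ _)) (fun n => ?_)
      (fun i => ?_)
    · exact iIndepFun_iff_finset.1 (iIndepFun_blockIncrement hν (hPlaw n)
        (a := fun l => dyadicAbove n (t l)) ((dyadicAbove_mono n).comp ht)) s
    · filter_upwards [hYae (t (i + 1)), hYae (t i)] with x hx1 hx2 using hx1.sub hx2
  · intro s h
    have hm : ∀ s t, AEMeasurable (fun x => Y x s - Y x t) P := fun s t =>
      ((hYm s).sub (hYm t)).aemeasurable
    refine ⟨hm _ _, hm _ _, ?_⟩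
    have := Measure.isProbabilityMeasure_map (hm (s + h) s)
    have := Measure.isProbabilityMeasure_map (hm h 0)
    refine Measure.ext_of_charFun (funext fun ξ => ?_)
    have h0 := hincr 0 h ξ
    rw [zero_add] at h0
    rw [hincr, h0]

end Existence

/-! ### Radial characteristic exponents -/

section RadialExponents

variable {k : ℕ} {Ω : Type*} [MeasurableSpace Ω] {P : Measure Ω}
  {X : ℝ≥0 → Ω → EuclideanSpace ℝ (Fin k)}

theorem IsLevyProcess.charFun_increment (hX : IsLevyProcess X P)
    {Ψ : EuclideanSpace ℝ (Fin k) → ℂ} (hΨ : HasCharExponent X P Ψ) (s h : ℝ≥0) (ξ) :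
    charFun (P.map fun ω => X (s + h) ω - X s ω) ξ = Complex.exp (-(((h : ℝ) : ℂ) * Ψ ξ)) := by
  rw [(hX.stationary_increments s h).map_eq, ← hΨ h ξ]
  congr 1
  refine Measure.map_congr ?_
  filter_upwards [hX.zero_ae] with ω hω
  rw [hω, sub_zero]

/-- The characteristic function of a marginal is the restriction to a coordinate axis. -/
theorem charFun_map_apply {d : ℕ} (μ : Measure (EuclideanSpace ℝ (Fin d))) (c : Fin d) (u : ℝ) :
    charFun (μ.map fun x => x c) u = charFun μ (EuclideanSpace.single c u) := by
  rw [charFun_apply, charFun_apply, integral_map (by fun_prop) (by fun_prop)]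
  refine integral_congr_ae (ae_of_all _ fun x => ?_)
  simp [EuclideanSpace.inner_single_right, mul_comm]

/-- A radial convolution semigroup with the exponent `ψ` of a lower-dimensional Lévy process is
realized by a Lévy process: all its coordinates have the increment laws of a coordinate of the
given process. -/
theorem IsLevyProcess.existsLevyProcess_of_radial [IsProbabilityMeasure P] (hk : 1 ≤ k)
    (hX : IsLevyProcess X P) {ψ : ℝ → ℂ} (hψ : HasCharExponent X P (fun ξ => ψ ‖ξ‖)) {d : ℕ}
    {ν : ℝ≥0 → Measure (EuclideanSpace ℝ (Fin d))} [∀ t, IsProbabilityMeasure (ν t)]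
    (hν : ∀ (t : ℝ≥0) ξ, charFun (ν t) ξ = Complex.exp (-(((t : ℝ) : ℂ) * ψ ‖ξ‖))) :
    ExistsLevyProcess d (fun ξ => ψ ‖ξ‖) := by
  let c₀ : Fin k := ⟨0, hk⟩
  have hXm := hX.measurable
  let proj : EuclideanSpace ℝ (Fin k) →L[ℝ] ℝ := EuclideanSpace.proj c₀
  have hchar : ∀ s h u, charFun (P.map fun ω => X (s + h) ω c₀ - X s ω c₀) u
      = Complex.exp (-(((h : ℝ) : ℂ) * ψ ‖u‖)) := by
    intro s h u
    have h1 := hX.charFun_increment hψ s h (EuclideanSpace.single c₀ u)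
    rw [← charFun_map_apply, Measure.map_map (by fun_prop) (by fun_prop),
      PiLp.norm_single] at h1
    exact h1
  have hprob : ∀ s h, IsProbabilityMeasure (P.map fun ω => X (s + h) ω c₀ - X s ω c₀) :=
    fun s h => Measure.isProbabilityMeasure_map (by fun_prop)
  refine existsLevyProcess_of_semigroup hν (W := fun t ω => X t ω c₀)
    (ρ := fun h => P.map fun ω => X (0 + h) ω c₀ - X 0 ω c₀) (P' := P)
    (fun t => by fun_prop) (hX.indep_increments.map proj) ?_ (fun s h => ?_) (fun c h => ?_)
  · filter_upwards [hX.cadlag] with ω hω t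
    obtain ⟨h1, l, hl⟩ := hω t
    exact ⟨(proj.continuous.tendsto _).comp h1, l c₀, (proj.continuous.tendsto l).comp hl⟩
  · have := hprob s h
    have := hprob 0 h
    refine Measure.ext_of_charFun (funext fun u => ?_)
    rw [hchar, hchar]
  · have := hprob 0 h
    have : IsProbabilityMeasure ((ν h).map fun x => x c) :=
      Measure.isProbabilityMeasure_map (by fun_prop)
    refine Measure.ext_of_charFun (funext fun u => ?_)
    rw [hchar, charFun_map_apply, hν, PiLp.norm_single]

theorem exists_isSmoothRadialDensity_of_hasCharExponent [IsProbabilityMeasure P] (hk : 1 ≤ k)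
    (hX : IsLevyProcess X P) {ψ : ℝ → ℂ} (hψ : HasCharExponent X P (fun ξ => ψ ‖ξ‖))
    (hHW : HartmanWintner ψ) :
    ∃ p : ℝ≥0 → ℝ → ℝ, ∀ t > 0, IsSmoothRadialDensity (P.map (X t)) (p t) := by
  have h : ∀ t : ℝ≥0, ∃ p : ℝ → ℝ, 0 < t → IsSmoothRadialDensity (P.map (X t)) p := by
    intro t
    by_cases ht : 0 < t
    · have := Measure.isProbabilityMeasure_map (μ := P) (hX.measurable t).aemeasurable
      obtain ⟨p, hp⟩ := exists_isSmoothRadialDensity hk hHW (NNReal.coe_pos.2 ht) _ (hψ t)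
      exact ⟨p, fun _ => hp⟩
    · exact ⟨0, fun h => absurd h ht⟩
  choose p hp using h
  exact ⟨p, fun t ht => hp t ht⟩

/-- Two laws on `ℝᵏ` and `ℝᵏ⁺²` with the same radial characteristic function are related by
projection, which determines the density of the second from that of the first. -/
theorem IsSmoothRadialDensity.eq_deriv_of_charFun_eq (hk : 1 ≤ k)
    {μ : Measure (EuclideanSpace ℝ (Fin k))} [IsProbabilityMeasure μ]
    {ν : Measure (EuclideanSpace ℝ (Fin (k + 2)))} [IsProbabilityMeasure ν] {f : ℝ → ℂ}
    (hμ : ∀ ξ, charFun μ ξ = f ‖ξ‖) (hν : ∀ ξ, charFun ν ξ = f ‖ξ‖) {p q : ℝ → ℝ}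
    (hp : IsSmoothRadialDensity μ p) (hq : IsSmoothRadialDensity ν q) {r : ℝ} (hr : 0 < r) :
    q r = -(1 / (2 * Real.pi)) * (1 / r) * deriv p r := by
  obtain ⟨L⟩ := exists_prodComplex_linearIsometryEquiv k
  refine hp.eq_deriv_of_map_fst hk L hq ?_ hr
  refine Measure.ext_of_charFun (funext fun ξ => ?_)
  rw [charFun_map_fst, hν, hμ, norm_toLp_fst]

end RadialExponents

/-! ### Equivalence of the three conditions -/

theorem mainTheorem2 (k : ℕ) (hk : 1 ≤ k)
    {Ω : Type*} [MeasurableSpace Ω] (P : Measure Ω) [IsProbabilityMeasure P]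
    (X : ℝ≥0 → Ω → EuclideanSpace ℝ (Fin k)) (hX : IsLevyProcess X P)
    (ψ : ℝ → ℂ) (hψ : HasCharExponent X P (fun ξ => ψ ‖ξ‖)) (hHW : HartmanWintner ψ) :
    -- for every `t > 0` the law of `X t` has a smooth rotationally invariant density
    (∃ p : ℝ≥0 → ℝ → ℝ, ∀ t > 0, IsSmoothRadialDensity (P.map (X t)) (p t)) ∧
    ∀ p : ℝ≥0 → ℝ → ℝ, (∀ t > 0, IsSmoothRadialDensity (P.map (X t)) (p t)) →
      List.TFAE [
        ExistsLevyProcess (k + 2) (fun ξ => ψ ‖ξ‖),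
        ∀ t > 0, ∀ r > 0, deriv (p t) r ≤ 0,
        ∀ t > 0, IsUnimodalIsotropic (X t) P] ∧
      -- the densities of any `(k+2)`-dimensional process as in the first condition
      ∀ {Ω' : Type*} [MeasurableSpace Ω'] (P' : Measure Ω') [IsProbabilityMeasure P']
        (Y : ℝ≥0 → Ω' → EuclideanSpace ℝ (Fin (k + 2))),
        IsLevyProcess Y P' → HasCharExponent Y P' (fun ξ => ψ ‖ξ‖) →
        (∃ q : ℝ≥0 → ℝ → ℝ, ∀ t > 0, IsSmoothRadialDensity (P'.map (Y t)) (q t)) ∧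
        ∀ q : ℝ≥0 → ℝ → ℝ, (∀ t > 0, IsSmoothRadialDensity (P'.map (Y t)) (q t)) →
          ∀ t > 0, ∀ r > 0, q t r = -(1 / (2 * Real.pi)) * (1 / r) * deriv (p t) r := by
  have hprob : ∀ t, IsProbabilityMeasure (P.map (X t)) := fun t =>
    Measure.isProbabilityMeasure_map (hX.measurable t).aemeasurable
  refine ⟨exists_isSmoothRadialDensity_of_hasCharExponent hk hX hψ hHW, fun p hp => ⟨?_, ?_⟩⟩
  · tfae_have 1 → 2 := by
      rintro ⟨Ω', _, P', Y, _, hY, hYψ⟩ t ht r hr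
      have := Measure.isProbabilityMeasure_map (μ := P') (hY.measurable t).aemeasurable
      obtain ⟨q, hq⟩ := exists_isSmoothRadialDensity_of_hasCharExponent (by omega) hY hYψ hHW
      have h := (hp t ht).eq_deriv_of_charFun_eq hk
        (f := fun r => Complex.exp (-(((t : ℝ) : ℂ) * ψ r))) (hψ t) (hYψ t) (hq t ht) hr
      have hq0 := (hq t ht).nonneg r hr.le
      rw [h] at hq0
      by_contra! hpos
      have : 0 < 1 / (2 * Real.pi) * (1 / r) * deriv (p t) r := by positivity
      linarith
    tfae_have 2 → 1 := by
      intro h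
      have hlift : ∀ t : ℝ≥0, ∃ ν : Measure (EuclideanSpace ℝ (Fin (k + 2))),
          IsProbabilityMeasure ν ∧
          ∀ ξ, charFun ν ξ = Complex.exp (-(((t : ℝ) : ℂ) * ψ ‖ξ‖)) := by
        intro t
        rcases eq_or_ne t 0 with rfl | ht
        · exact ⟨Measure.dirac 0, inferInstance, fun ξ => by simp [charFun_dirac]⟩
        · have ht' : 0 < t := pos_iff_ne_zero.2 ht
          obtain ⟨ν, hν, hνμ⟩ := (hp t ht').exists_radial_lift hk
            (((hp t ht').deriv_nonpos_iff hk).1 (h t ht'))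
          refine ⟨ν, hν, fun ξ => ?_⟩
          have hn : ‖(EuclideanSpace.single ⟨0, hk⟩ ‖ξ‖ : EuclideanSpace ℝ (Fin k))‖ = ‖ξ‖ := by
            rw [PiLp.norm_single, norm_norm]
          -- any vector of `ℝᵏ` of length `‖ξ‖` carries the value of the characteristic function
          rw [hνμ ξ _ hn.symm, hψ t]
          simp only [hn]
      choose ν hν hνψ using hlift
      exact hX.existsLevyProcess_of_radial hk hψ hνψ
    tfae_have 2 ↔ 3 := forall₂_congr fun t ht => ((hp t ht).deriv_nonpos_iff hk).trans
      ((hp t ht).antitoneOn_iff_isUnimodalIsotropic hk (hX.measurable t))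
    tfae_finish
  · intro Ω' _ P' _ Y hY hYψ
    refine ⟨exists_isSmoothRadialDensity_of_hasCharExponent (by omega) hY hYψ hHW,
      fun q hq t ht r hr => ?_⟩
    have := Measure.isProbabilityMeasure_map (μ := P') (hY.measurable t).aemeasurable
    exact (hp t ht).eq_deriv_of_charFun_eq hk
      (f := fun r => Complex.exp (-(((t : ℝ) : ℂ) * ψ r))) (hψ t) (hYψ t) (hq t ht) hr
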